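/- **Setting.** Let $\Phi$ be an irreducible (finite, reduced, crystallographic) root system of rank $\ell$ in a real vector space, with Weyl group $W$; let $V$ be the dual space, on which the roots act as linear forms $x\mapsto(\alpha,x)$ (with a $W$-invariant inner product, $V$ may be identified with the space containing $\Phi$). Fix simple roots $\alpha_1,\dots,\alpha_\ell$ and the corresponding positive roots $\Phi^+$. Let $\widetilde\alpha=\sum_{i=1}^{\ell}c_i\alpha_i$ be the highest root, and put $\alpha_0=-\widetilde\alpha$, $c_0=1$. Let $Z=\{x\in V\mid(\alpha_i,x)\in\mathbb Z,\ 1\le i\le\ell\}$ be the coweight lattice and let $f$ be the index in $Z$ of the lattice spanned by the coroots. A *quasi-polynomial* is a function $\mathbb Z\to\mathbb Q$ for which there is an integer $m>0$ such that on each residue class modulo $m$ the function agrees with a polynomial with rational coefficients. * *Characteristic quasi-polynomial.* For integers $a\le b$ let $\mathcal A_\Phi^{[a,b]}$ be the arrangement of the hyperplanes $\{x\in V\mid(\alpha,x)=k\}$ with $\alpha\in\Phi^+$, $k\in\mathbb Z$, $a\le k\le b$. Its characteristic quasi-polynomial $\chi_{\mathrm{quasi}}(\mathcal A_\Phi^{[a,b]},\cdot)$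 is the quasi-polynomial whose value at every sufficiently large positive integer $q$ is $$\#\{\overline x\in Z/qZ\mid(\alpha,x)\not\equiv k\bmod q\ \text{ for all }\alpha\in\Phi^+,\ a\le k\le b\}.$$ * *Ehrhart quasi-polynomial.* Let $\overline{A}=\{x\in V\mid(\alpha_i,x)\ge0\ (1\le i\le\ell),\ (\widetilde\alpha,x)\le1\}$ be the closed fundamental alcove, and let $\mathrm L_{\overline A}$ be the quasi-polynomial with $\mathrm L_{\overline A}(q)=\#(q\overline A\cap Z)$ for all integers $q>0$. * *Generalized Eulerian polynomial.* For $w\in W$ let $\operatorname{asc}(w)$ be the sum of the $c_i$ over those $0\le i\le\ell$ for which $w(\alpha_i)$ is a positive root, and let $$R_\Phi(t)=\frac1f\sum_{w\in W}t^{\operatorname{asc}(w)}.$$ * *Shift operator.* For a polynomial $P(S)=\sum_k a_kS^k$ and a function $g$ on $\mathbb Z$, let $(P(S)g)(q)=\sum_k a_k\,g(q-k)$. **Theorem.** Let $n\ge1$. The quasi-polynomial $\mathrm L_{\overline A}$ and the characteristic quasi-polynomial of the Linial arrangement $\mathcal A_\Phi^{[1,n]}$ exist and are unique, and for all $q\in\mathbb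 Z$ $$\chi_{\mathrm{quasi}}(\mathcal A_\Phi^{[1,n]},q)=\bigl(R_\Phi(S^{n+1})\,\mathrm L_{\overline A}\bigr)(q).$$ -/

import Mathlib

open Polynomial
open scoped Pointwise

noncomputable section

/-! ### Quasi-polynomials and the shift operator -/

/-- `f : ℤ → ℚ` is a quasi-polynomial: there are a period `m > 0` and polynomials `g r`, one for
each residue class `r` modulo `m`, such that `f q = g r (q)` whenever `q ≡ r` modulo `m`. -/
def IsQuasiPolynomial (f : ℤ → ℚ) : Prop :=
  ∃ m : ℕ, 0 < m ∧ ∃ g : ZMod m → ℚ[X], ∀ q : ℤ, f q = (g (q : ZMod m)).eval (q : ℚ)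

/-- The action of a polynomial `p(S) = ∑ₖ aₖ Sᵏ` in the shift operator `(S f)(t) = f (t - 1)`:
`(p(S) f)(t) = ∑ₖ aₖ f (t - k)`. -/
def shiftAct (p : ℚ[X]) (f : ℤ → ℚ) : ℤ → ℚ :=
  fun t => p.sum fun k a => a * f (t - k)

/-! ### Characteristic quasi-polynomials -/

section Arrangement

variable {L : Type*} [AddCommGroup L]

/-- An integral arrangement in `L ⊗ ℝ` is given by pairs `(α, k)` of an integral linear form `α` on
the lattice `L` and an integer `k`, standing for the hyperplane `α = k`. This is the complement of
the arrangement modulo `q`: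
`M(A; q) = {x̄ ∈ L / qL ∣ α(x) ≢ k mod q for all (α, k) ∈ A}`. -/
def modComplement (A : Set (Module.Dual ℤ L × ℤ)) (q : ℕ) : Set (ModN L q) :=
  {y | ∀ x : L, ModN.mkQ q x = y → ∀ H ∈ A, ¬ H.1 x ≡ H.2 [ZMOD q]}

/-- `χ` is the characteristic quasi-polynomial of `A`: the quasi-polynomial with
`χ q = #M(A; q)` for all large positive integers `q`. -/
def IsCharacteristicQuasiPolynomial (A : Set (Module.Dual ℤ L × ℤ)) (χ : ℤ → ℚ) : Prop :=
  IsQuasiPolynomial χ ∧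
    ∃ q₀ : ℕ, ∀ q : ℕ, q₀ < q → χ (q : ℤ) = ((modComplement A q).ncard : ℚ)

end Arrangement

/-- `E` is the Ehrhart quasi-polynomial of the polytope `K` with respect to the lattice `L`: the
quasi-polynomial with `E q = #(qK ∩ L)` for all positive integers `q`. -/
def IsEhrhartQuasiPolynomial {V : Type*} [AddCommGroup V] [Module ℝ V]
    (L : Submodule ℤ V) (K : Set V) (E : ℤ → ℚ) : Prop :=
  IsQuasiPolynomial E ∧
    ∀ q : ℕ, 0 < q → E (q : ℤ) = ((((q : ℝ) • K) ∩ (L : Set V)).ncard : ℚ)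

/-! ### Root systems -/

namespace RootPairing.Base

variable {ι M N : Type*} [AddCommGroup M] [Module ℝ M] [AddCommGroup N] [Module ℝ N]
  {P : RootPairing ι ℝ M N} (b : P.Base)

/-- The coweight lattice: the points at which all simple roots take integer values. The roots
are regarded as linear forms on `N` through the perfect pairing of `M` and `N`. -/
def coweightLattice : Submodule ℤ N where
  carrier := {x | ∀ i ∈ b.support, ∃ m : ℤ, P.root' i x = m}
  zero_mem' := fun i _ => ⟨0, by simp⟩
  add_mem' := by
    intro x y hx hy i hi
    obtain ⟨m, hm⟩ := hx i hi
    obtain ⟨k, hk⟩ := hy i hi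
    exact ⟨m + k, by rw [map_add, hm, hk]; push_cast; rfl⟩
  smul_mem' := by
    intro c x hx i hi
    obtain ⟨m, hm⟩ := hx i hi
    exact ⟨c * m, by rw [map_zsmul, hm]; simp⟩

/-- Every root, not only the simple ones, is integral on the coweight lattice. -/
lemma exists_int_root'_eq (i : ι) (x : b.coweightLattice) :
    ∃ m : ℤ, P.root' i (x : N) = m := by
  have key : ∀ v ∈ Submodule.span ℤ (P.root '' b.support),
      ∃ m : ℤ, P.toLinearMap v (x : N) = m := by
    intro v hv
    induction hv using Submodule.span_induction with
    | mem v hv => obtain ⟨j, hj, rfl⟩ := hv; exact x.2 j hj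
    | zero => exact ⟨0, by simp⟩
    | add v w _ _ hv hw =>
      obtain ⟨m, hm⟩ := hv
      obtain ⟨k, hk⟩ := hw
      exact ⟨m + k, by rw [map_add, LinearMap.add_apply, hm, hk]; push_cast; rfl⟩
    | smul c v _ hv =>
      obtain ⟨m, hm⟩ := hv
      exact ⟨c * m, by rw [map_zsmul, LinearMap.smul_apply, hm]; simp⟩
  exact key _ (b.root_mem_span_int i)

/-- A root as an integral linear form on the coweight lattice. -/
def rootForm (i : ι) : Module.Dual ℤ b.coweightLattice :=
  AddMonoidHom.toIntLinearMap
    { toFun := fun x => (b.exists_int_root'_eq i x).choose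
      map_zero' := by
        have h := (b.exists_int_root'_eq i 0).choose_spec
        have h' : (((b.exists_int_root'_eq i 0).choose : ℤ) : ℝ) = 0 := by rw [← h]; simp
        exact_mod_cast h'
      map_add' := by
        intro x y
        have hx := (b.exists_int_root'_eq i x).choose_spec
        have hy := (b.exists_int_root'_eq i y).choose_spec
        have hxy := (b.exists_int_root'_eq i (x + y)).choose_spec
        have h' : (((b.exists_int_root'_eq i (x + y)).choose : ℤ) : ℝ) =
            ((b.exists_int_root'_eq i x).choose : ℤ) +
              ((b.exists_int_root'_eq i y).choose : ℤ) := by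
          rw [← hx, ← hy, ← hxy]; simp
        exact_mod_cast h' }

lemma coe_rootForm (i : ι) (x : b.coweightLattice) :
    ((b.rootForm i x : ℤ) : ℝ) = P.root' i (x : N) :=
  (b.exists_int_root'_eq i x).choose_spec.symm

/-- The truncated affine Weyl arrangement `{H_{α, k} ∣ α ∈ Φ⁺, k ∈ ℤ, u ≤ k ≤ v}`. -/
def truncatedAffineWeyl (u v : ℤ) : Set (Module.Dual ℤ b.coweightLattice × ℤ) :=
  {H | ∃ i, b.IsPos i ∧ H.1 = b.rootForm i ∧ u ≤ H.2 ∧ H.2 ≤ v}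

/-- The index of connection: the index of the coroot lattice in the coweight lattice. -/
def connectionIndex : ℕ :=
  (P.corootSpan ℤ).toAddSubgroup.relIndex b.coweightLattice.toAddSubgroup

/-- The Weyl group is finite, so that the sum over it below is an honest finite sum. -/
lemma finite_weylGroup [Finite ι] [P.IsRootSystem] : Finite P.weylGroup := by
  refine Finite.of_injective P.weylGroupToPerm fun g h hgh => ?_
  refine Subtype.ext (RootPairing.Equiv.weightHom_injective P
    (LinearEquiv.toLinearMap_injective ?_))
  refine LinearMap.ext_on_range (v := P.root) IsRootSystem.span_root_eq_top fun i => ?_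
  have hg := P.weylGroup_apply_root g i
  have hh := P.weylGroup_apply_root h i
  rw [hgh, ← hh] at hg
  exact hg

section HighestRoot

variable [Finite ι] [Nonempty ι]

/-- The (index of the) highest root: the root of maximal height. -/
def highestRoot : ι := (Finite.exists_max b.height).choose

lemma height_le_height_highestRoot (i : ι) : b.height i ≤ b.height b.highestRoot :=
  (Finite.exists_max b.height).choose_spec i

/-- The closed fundamental alcove: all simple roots are `≥ 0` and the highest root is `≤ 1`. -/
def closedFundamentalAlcove : Set N :=
  {x | (∀ i ∈ b.support, 0 ≤ P.root' i x) ∧ P.root' b.highestRoot x ≤ 1}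

/-- The (index of the) root `αⱼ` of the extended base: `none` stands for `j = 0`, where `α₀` is
minus the highest root; the other `αⱼ` are the simple roots. -/
def extendedRoot : Option b.support → ι
  | none => P.reflectionPerm b.highestRoot b.highestRoot
  | some i => i

/-- The coefficients `cⱼ`: `c₀ = 1`, and the highest root is `∑ cⱼ αⱼ` over the simple roots. The
coefficients of the highest root are nonnegative (see `root_highestRoot_eq_sum`), so `toNat` only
changes their type. -/
def extendedCoeff : Option b.support → ℕ
  | none => 1
  | some i => (b.toWeightBasisInt.repr (P.rootSpanMem ℤ b.highestRoot) i).toNat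

lemma root_extendedRoot_none : P.root (b.extendedRoot none) = -P.root b.highestRoot := by
  simp [extendedRoot]

lemma root_highestRoot_eq_sum :
    P.root b.highestRoot = ∑ i : b.support, b.extendedCoeff (some i) • P.root i := by
  have hsum : P.root b.highestRoot =
      ∑ i : b.support, b.toWeightBasisInt.repr (P.rootSpanMem ℤ b.highestRoot) i • P.root i := by
    have h := congrArg (Submodule.subtype _)
      (b.toWeightBasisInt.sum_repr (P.rootSpanMem ℤ b.highestRoot))
    rw [map_sum] at h
    simpa using h.symm
  set z := b.toWeightBasisInt.repr (P.rootSpanMem ℤ b.highestRoot) with hz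
  have hpos : 0 < b.height b.highestRoot := by
    obtain ⟨i, hi⟩ := b.support_nonempty
    have h1 := b.height_le_height_highestRoot i
    rw [height_one_of_mem_support hi] at h1
    lia
  obtain ⟨f, -, hf, hf'⟩ := b.exists_root_eq_sum_int b.highestRoot
  have hfz (i : b.support) : f i = z i := by
    have h2 : ∑ i : b.support, f i • P.root i = ∑ i : b.support, z i • P.root i := by
      rw [← hsum, hf', ← b.support.sum_finset_coe]; rfl
    exact Fintype.linearIndependent_iffₛ.mp
      (b.linearIndepOn_root.restrict_scalars' ℤ) (fun i => f i) (fun i => z i) h2 i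
  have hf0 : 0 < f := by
    refine hf.resolve_right fun hneg => ?_
    rw [height_eq_sum hf'] at hpos
    exact absurd hpos (not_lt.mpr (Finset.sum_nonpos fun i _ => hneg.le i))
  rw [hsum]
  refine Finset.sum_congr rfl fun i _ => ?_
  have h3 : 0 ≤ z i := by rw [← hfz]; exact hf0.le i
  have h4 : ((b.extendedCoeff (some i) : ℕ) : ℤ) = z i := Int.toNat_of_nonneg h3
  rw [← h4, natCast_zsmul]

open Classical in
/-- `asc(w) = ∑ cⱼ` over the `j ∈ {0, …, ℓ}` with `w(αⱼ) > 0`. -/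
def asc (w : P.weylGroup) : ℕ :=
  ∑ j : Option b.support with b.IsPos (P.weylGroupToPerm w (b.extendedRoot j)), b.extendedCoeff j

/-- The generalized Eulerian polynomial `R(t) = f⁻¹ ∑_{w ∈ W} t ^ asc(w)`, where `f` is the index
of connection. -/
def eulerianPolynomial : ℚ[X] :=
  C (b.connectionIndex : ℚ)⁻¹ * ∑ᶠ w : P.weylGroup, X ^ b.asc w

end HighestRoot

end RootPairing.Base

end

/-! The identity comes from counting `alcovePairs n q` twice. Its elements are pairs `(w, x)` with
`w` in the Weyl group `W` and `x` a coweight of the closed alcove dilated by `q`, at distance more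
than `n` from each wall `αⱼ` with `w(αⱼ) > 0`.

Fix `w`. The distances `aⱼ` of `x` to the walls determine `x`, and their only relation is `∑ cⱼ aⱼ =
q`. Pushing the relevant walls inwards by `n + 1` leaves the lattice points of the alcove dilated by
`q - (n + 1) asc(w)`. Summing over `w` gives `f` times the right-hand side for large `q`
(`ncard_alcovePairs_eq_sum`).

The other count is `f · #M(q)`, with `M(q)` the complement of the Linial arrangement modulo `q`
(`ncard_alcovePairs`). The affine Weyl group moves every coweight into the closed alcove, but points
on walls can be reached in several ways. The strict inequalities for `n = 0` break these ties. Let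
`H` be the height of the highest root plus one. Then `(w, x)` is in `alcovePairs 0 q` exactly when
the image under `w` of a perturbed point `H(y + qz) - ρ̌`, written as `Hx - wρ̌` up to translation,
lies in the open alcove at level `Hq`. Since `0 < |ht α| < H`, such a point lies on no wall, so
exactly one affine Weyl element moves it into the open alcove (`exists_mem_openAlcove`,
`eq_one_of_mem_openAlcove`). Thus a class of `y` modulo `q` and a class of `z` modulo the coroot
lattice determine one pair, and each `y` receives `f` pairs. Under this matching, distance more than
`n` means that `y` avoids the Linial arrangement modulo `q` (`mem_alcovePairs_iff`).

The number of points in the dilated alcove is a partition count with part sizes `cⱼ`, hence a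
quasi-polynomial, and its shifts therefore give the characteristic quasi-polynomial. Uniqueness
holds because quasi-polynomials that agree at all large integers are equal. -/

noncomputable section

namespace RootPairing.Base

/-! ### Coefficients of roots over the simple roots -/

section RootCoeff

variable {ι M N : Type*} [AddCommGroup M] [Module ℝ M] [AddCommGroup N] [Module ℝ N]
  {P : RootPairing ι ℝ M N} (b : P.Base)

/-- The coefficients of a root with respect to the simple roots. -/
def rootCoeff (i : ι) (j : b.support) : ℤ :=
  b.toWeightBasisInt.repr (P.rootSpanMem ℤ i) j

lemma root_eq_sum_rootCoeff (i : ι) :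
    P.root i = ∑ j : b.support, b.rootCoeff i j • P.root j := by
  have h := congrArg (Submodule.subtype _) (b.toWeightBasisInt.sum_repr (P.rootSpanMem ℤ i))
  rw [map_sum] at h
  simpa [rootCoeff] using h.symm

variable {b} in
lemma eq_rootCoeff_of_root_eq_sum {i : ι} {f : b.support → ℤ}
    (h : P.root i = ∑ j : b.support, f j • P.root j) : f = b.rootCoeff i := by
  refine funext fun j => Fintype.linearIndependent_iffₛ.mp
    (b.linearIndepOn_root.restrict_scalars' ℤ) f (b.rootCoeff i) ?_ j
  exact h.symm.trans (b.root_eq_sum_rootCoeff i)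

lemma rootCoeff_injective : Function.Injective b.rootCoeff := by
  intro i k h
  apply P.root.injective
  rw [b.root_eq_sum_rootCoeff i, b.root_eq_sum_rootCoeff k, h]

lemma rootCoeff_add {i j k : ι} (h : P.root k = P.root i + P.root j) :
    b.rootCoeff k = b.rootCoeff i + b.rootCoeff j := by
  refine (eq_rootCoeff_of_root_eq_sum ?_).symm
  rw [h, b.root_eq_sum_rootCoeff i, b.root_eq_sum_rootCoeff j, ← Finset.sum_add_distrib]
  simp [add_smul]

lemma rootCoeff_neg {i k : ι} (h : P.root k = -P.root i) :
    b.rootCoeff k = -b.rootCoeff i := by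
  refine (eq_rootCoeff_of_root_eq_sum ?_).symm
  rw [h, b.root_eq_sum_rootCoeff i]
  simp

open Classical in
lemma rootCoeff_simple (i : b.support) : b.rootCoeff i = Pi.single i 1 := by
  refine (eq_rootCoeff_of_root_eq_sum ?_).symm
  rw [Finset.sum_eq_single i] <;> simp +contextual

lemma height_eq_sum_rootCoeff (i : ι) : b.height i = ∑ j, b.rootCoeff i j := by
  classical
  have h : P.root i = ∑ j ∈ b.support,
      (fun j => if h : j ∈ b.support then b.rootCoeff i ⟨j, h⟩ else 0) j • P.root j := by
    rw [b.root_eq_sum_rootCoeff i, ← b.support.sum_coe_sort]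
    simp
  rw [height_eq_sum h, ← b.support.sum_coe_sort]
  simp

lemma rootCoeff_nonneg_or_nonpos (i : ι) : 0 ≤ b.rootCoeff i ∨ b.rootCoeff i ≤ 0 := by
  obtain ⟨f, -, hf, hsum⟩ := b.exists_root_eq_sum_int i
  have h : (fun j : b.support => f j) = b.rootCoeff i := by
    refine eq_rootCoeff_of_root_eq_sum ?_
    rw [hsum, ← b.support.sum_coe_sort]
  rw [← h]
  exact hf.imp (fun h j => h.le j) (fun h j => h.le j)

variable {b} in
lemma IsPos.rootCoeff_nonneg {i : ι} (h : b.IsPos i) : 0 ≤ b.rootCoeff i := by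
  refine (b.rootCoeff_nonneg_or_nonpos i).resolve_right fun h' => ?_
  rw [isPos_iff, height_eq_sum_rootCoeff] at h
  exact absurd h (not_lt.mpr (Finset.sum_nonpos fun j _ => h' j))

lemma rootCoeff_nonpos_of_not_isPos {i : ι} (h : ¬ b.IsPos i) : b.rootCoeff i ≤ 0 := by
  refine (b.rootCoeff_nonneg_or_nonpos i).resolve_left fun h' => h ?_
  rw [isPos_iff', height_eq_sum_rootCoeff]
  exact Finset.sum_nonneg fun j _ => h' j

variable {b} in
lemma IsPos.exists_rootCoeff_pos {i : ι} (h : b.IsPos i) : ∃ j, 0 < b.rootCoeff i j := by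
  by_contra! h'
  rw [isPos_iff, height_eq_sum_rootCoeff] at h
  exact absurd h (not_lt.mpr (Finset.sum_nonpos fun j _ => h' j))

lemma pairingIn_eq_sum_rootCoeff [P.IsCrystallographic] (i k : ι) :
    P.pairingIn ℤ i k = ∑ j : b.support, b.rootCoeff i j * P.pairingIn ℤ j k := by
  apply FaithfulSMul.algebraMap_injective ℤ ℝ
  simp_rw [map_sum, map_mul, algebraMap_pairingIn, ← root_coroot_eq_pairing]
  conv_lhs => rw [b.root_eq_sum_rootCoeff i]
  simp

lemma isPos_of_rootCoeff_maximal [Nonempty ι] {i : ι}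
    (hi : ∀ k, b.rootCoeff i ≤ b.rootCoeff k → k = i) : b.IsPos i := by
  by_contra h
  obtain ⟨j, hj⟩ := b.support_nonempty
  have := hi j ((b.rootCoeff_nonpos_of_not_isPos h).trans
    (b.isPos_of_mem_support hj).rootCoeff_nonneg)
  exact h (this ▸ b.isPos_of_mem_support hj)

lemma isPos_highestRoot [Finite ι] [Nonempty ι] : b.IsPos b.highestRoot := by
  obtain ⟨j, hj⟩ := b.support_nonempty
  exact (b.isPos_of_mem_support hj).trans_le (b.height_le_height_highestRoot j)

lemma coe_extendedCoeff_some [Finite ι] [Nonempty ι] (j : b.support) :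
    (b.extendedCoeff (some j) : ℤ) = b.rootCoeff b.highestRoot j :=
  Int.toNat_of_nonneg (b.isPos_highestRoot.rootCoeff_nonneg j)

end RootCoeff

/-! ### Domination by the highest root -/

section Highest

variable {ι M N : Type*} [AddCommGroup M] [Module ℝ M] [AddCommGroup N] [Module ℝ N]
  {P : RootPairing ι ℝ M N} (b : P.Base) [Finite ι] [P.IsCrystallographic]

/-- With a negative pairing, adding the simple root would give a larger root; the case of opposite
roots is separate, the sum then being zero. -/
lemma pairingIn_nonneg_of_rootCoeff_maximal {i : ι}
    (hi : ∀ k, b.rootCoeff i ≤ b.rootCoeff k → k = i) {j : ι} (hj : j ∈ b.support) :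
    0 ≤ P.pairingIn ℤ i j := by
  classical
  by_contra! h
  have hsingle : (0 : b.support → ℤ) ≤ Pi.single ⟨j, hj⟩ 1 := Pi.single_nonneg.mpr zero_le_one
  have hj' := b.rootCoeff_simple ⟨j, hj⟩
  dsimp only at hj'
  by_cases hij : P.root i = -P.root j
  · have h1 := b.rootCoeff_neg hij
    have := hi j (by rw [h1, hj']; exact (neg_nonpos.mpr hsingle).trans hsingle)
    subst this
    simp at h
  · obtain ⟨k, hk⟩ := P.root_add_root_mem_of_pairingIn_neg h hij
    have h1 := b.rootCoeff_add hk
    have := hi k (by rw [h1, hj']; exact le_add_of_nonneg_right hsingle)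
    subst this
    exact P.ne_zero j (by simpa using hk)

variable [Nonempty ι] [P.IsReduced] [P.IsIrreducible]

/-- Positivity spreads along the connected Dynkin diagram: a zero coefficient next to a positive one
would make the pairing with that simple coroot negative. -/
lemma rootCoeff_pos_of_maximal {i : ι}
    (hi : ∀ k, b.rootCoeff i ≤ b.rootCoeff k → k = i) (j : b.support) : 0 < b.rootCoeff i j := by
  have hpos := b.isPos_of_rootCoeff_maximal hi
  obtain ⟨j₀, hj₀⟩ := hpos.exists_rootCoeff_pos
  refine b.induction_on_cartanMatrix (fun j => 0 < b.rootCoeff i j) hj₀ fun k l hk hlk => ?_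
  by_contra hl
  have hl0 : b.rootCoeff i l = 0 := le_antisymm (not_lt.mp hl) (hpos.rootCoeff_nonneg l)
  have hne : k ≠ l := by rintro rfl; exact hl hk
  have hlt : P.pairingIn ℤ k l < 0 := by
    refine lt_of_le_of_ne (b.pairingIn_le_zero_of_ne (fun h => hne (Subtype.ext h)) k.2 l.2) ?_
    rw [ne_eq, P.pairingIn_eq_zero_iff]
    exact hlk
  refine absurd (b.pairingIn_nonneg_of_rootCoeff_maximal hi l.2) (not_le.mpr ?_)
  rw [b.pairingIn_eq_sum_rootCoeff]
  refine Finset.sum_neg' (fun m _ => ?_) ⟨k, Finset.mem_univ _, mul_neg_of_pos_of_neg hk hlt⟩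
  rcases eq_or_ne m l with rfl | hm
  · simp [hl0]
  · exact mul_nonpos_of_nonneg_of_nonpos (hpos.rootCoeff_nonneg m)
      (b.pairingIn_le_zero_of_ne (fun h => hm (Subtype.ext h)) m.2 l.2)

/-- Two maximal roots pair positively, so if distinct they differ by a root, whose sign makes one
dominate the other. -/
lemma rootCoeff_maximal_unique {i k : ι}
    (hi : ∀ l, b.rootCoeff i ≤ b.rootCoeff l → l = i)
    (hk : ∀ l, b.rootCoeff k ≤ b.rootCoeff l → l = k) : i = k := by
  by_contra hne
  have hkpos := b.isPos_of_rootCoeff_maximal hk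
  have hpair : 0 < P.pairingIn ℤ i k := by
    rw [b.pairingIn_eq_sum_rootCoeff]
    obtain ⟨j, hj, hjk⟩ := hkpos.exists_mem_support_pos_pairingIn
    refine Finset.sum_pos' (fun m _ => ?_) ⟨⟨j, hj⟩, Finset.mem_univ _,
      mul_pos (b.rootCoeff_pos_of_maximal hi _) hjk⟩
    refine mul_nonneg (b.rootCoeff_pos_of_maximal hi m).le ?_
    have h := b.pairingIn_nonneg_of_rootCoeff_maximal hk m.2
    by_contra! h'
    exact absurd ((P.pairingIn_lt_zero_iff ℤ).mp h') (not_lt.mpr h)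
  obtain ⟨l, hl⟩ := P.root_sub_root_mem_of_pairingIn_pos hpair hne
  have hsum := b.rootCoeff_add (i := l) (j := k) (k := i) (by rw [hl]; abel)
  rcases b.rootCoeff_nonneg_or_nonpos l with h | h
  · exact hne (hk i (by rw [hsum]; exact le_add_of_nonneg_left h))
  · exact hne (hi k (by rw [hsum]; exact add_le_of_nonpos_left h)).symm

/-- The coefficients of the highest root dominate those of every other root. -/
lemma rootCoeff_le_highestRoot (i : ι) : b.rootCoeff i ≤ b.rootCoeff b.highestRoot := by
  -- Height is the sum of the coefficients, so maximal height implies maximality in the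
  -- coefficientwise order.
  have hmax : ∀ l, b.rootCoeff b.highestRoot ≤ b.rootCoeff l → l = b.highestRoot := by
    intro l hl
    have hle := b.height_le_height_highestRoot l
    rw [height_eq_sum_rootCoeff, height_eq_sum_rootCoeff] at hle
    refine (b.rootCoeff_injective (le_antisymm hl fun j => ?_)).symm
    exact ((Finset.sum_eq_sum_iff_of_le fun j _ => hl j).mp
      (le_antisymm (Finset.sum_le_sum fun j _ => hl j) hle) j (Finset.mem_univ j)).ge
  obtain ⟨-, hle, ⟨k, rfl⟩, hk⟩ :=
    (Set.finite_range b.rootCoeff).exists_le_maximal (Set.mem_range_self i)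
  refine hle.trans (le_of_eq ?_)
  rw [b.rootCoeff_maximal_unique (i := k) (fun l hl =>
    b.rootCoeff_injective (le_antisymm (hk ⟨l, rfl⟩ hl) hl)) hmax]

lemma extendedCoeff_pos (j : Option b.support) : 0 < b.extendedCoeff j := by
  classical
  cases j with
  | none => exact one_pos
  | some j =>
    have h := b.rootCoeff_le_highestRoot j j
    rw [b.rootCoeff_simple, Pi.single_eq_same, ← b.coe_extendedCoeff_some] at h
    lia

end Highest

end RootPairing.Base
end

noncomputable section

namespace RootPairing.Base

variable {ι M N : Type*} [AddCommGroup M] [Module ℝ M] [AddCommGroup N] [Module ℝ N]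
  {P : RootPairing ι ℝ M N} (b : P.Base)

/-! ### Integer coordinates on the coweight lattice -/

section Coordinates

lemma rootForm_eq_sum_rootCoeff (i : ι) (x : b.coweightLattice) :
    b.rootForm i x = ∑ j : b.support, b.rootCoeff i j * b.rootForm j x := by
  have h : ((b.rootForm i x : ℤ) : ℝ) =
      ((∑ j : b.support, b.rootCoeff i j * b.rootForm j x : ℤ) : ℝ) := by
    push_cast
    simp_rw [coe_rootForm, RootPairing.root']
    conv_lhs => rw [b.root_eq_sum_rootCoeff i]
    simp
  exact_mod_cast h

lemma rootForm_neg {i k : ι} (h : P.root k = -P.root i) (x : b.coweightLattice) :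
    b.rootForm k x = -b.rootForm i x := by
  rw [b.rootForm_eq_sum_rootCoeff k, b.rootForm_eq_sum_rootCoeff i, b.rootCoeff_neg h]
  simp

variable {b} in
lemma coweightLattice_ext [P.IsRootSystem] {x y : b.coweightLattice}
    (h : ∀ j : b.support, b.rootForm j x = b.rootForm j y) : x = y := by
  apply Subtype.ext
  apply P.flip.toPerfPair.injective
  refine b.toWeightBasis.ext fun j => ?_
  have := congrArg (Int.cast : ℤ → ℝ) (h j)
  rw [coe_rootForm, coe_rootForm] at this
  simpa [RootPairing.root'] using this

/-- The values on the simple roots identify the coweight lattice with `ℤ ^ ℓ`. -/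
def coweightCoords [P.IsRootSystem] : b.coweightLattice ≃ₗ[ℤ] (b.support → ℤ) :=
  LinearEquiv.ofBijective (LinearMap.pi fun j : b.support => b.rootForm j) (by
    refine ⟨fun x y h => coweightLattice_ext fun j => congrFun h j, fun a => ?_⟩
    let z : N := P.flip.toPerfPair.symm (b.toWeightBasis.constr ℝ fun j => (a j : ℝ))
    have hz (j : b.support) : P.root' j z = a j := by
      have h : P.flip.toPerfPair z (b.toWeightBasis j) = a j := by
        rw [LinearEquiv.apply_symm_apply, Module.Basis.constr_basis]
      simpa [RootPairing.root'] using h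
    refine ⟨⟨z, fun j hj => ⟨a ⟨j, hj⟩, hz ⟨j, hj⟩⟩⟩, funext fun j => ?_⟩
    have h := b.coe_rootForm j ⟨z, fun j hj => ⟨a ⟨j, hj⟩, hz ⟨j, hj⟩⟩⟩
    rw [hz j] at h
    exact_mod_cast h)

@[simp]
lemma coweightCoords_apply [P.IsRootSystem] (x : b.coweightLattice) (j : b.support) :
    b.coweightCoords x j = b.rootForm j x := rfl

@[simp]
lemma rootForm_coweightCoords_symm [P.IsRootSystem] (a : b.support → ℤ) (j : b.support) :
    b.rootForm j (b.coweightCoords.symm a) = a j := by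
  rw [← coweightCoords_apply, LinearEquiv.apply_symm_apply]

/-- The sum of the fundamental coweights. -/
def rhoCheck [P.IsRootSystem] : b.coweightLattice := b.coweightCoords.symm 1

lemma rootForm_rhoCheck [P.IsRootSystem] (i : ι) : b.rootForm i b.rhoCheck = b.height i := by
  simp [b.rootForm_eq_sum_rootCoeff i, rhoCheck, height_eq_sum_rootCoeff]

variable {b} in
lemma natCast_smul_coweight_injective [P.IsRootSystem] {q : ℕ} (hq : 0 < q)
    {x y : b.coweightLattice} (h : (q : ℤ) • x = (q : ℤ) • y) : x = y := by
  refine coweightLattice_ext fun j => ?_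
  have h' := congrArg (b.rootForm j) h
  rw [map_zsmul, map_zsmul, smul_eq_mul, smul_eq_mul] at h'
  exact mul_left_cancel₀ (by exact_mod_cast hq.ne') h'

end Coordinates

/-! ### The coroot lattice -/

section Coroots

/-- The coroot lattice as a subgroup of the coweight lattice. -/
def corootSublattice : AddSubgroup b.coweightLattice :=
  (P.corootSpan ℤ).toAddSubgroup.comap b.coweightLattice.subtype.toAddMonoidHom

lemma index_corootSublattice : b.corootSublattice.index = b.connectionIndex := rfl

variable [P.IsCrystallographic]

/-- A coroot as an element of the coweight lattice. -/
def latticeCoroot (k : ι) : b.coweightLattice :=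
  ⟨P.coroot k, fun i _ => ⟨P.pairingIn ℤ i k, by
    rw [P.root'_coroot_eq_pairing]; exact (P.algebraMap_pairingIn ℤ i k).symm⟩⟩

@[simp]
lemma rootForm_latticeCoroot (i k : ι) : b.rootForm i (b.latticeCoroot k) = P.pairingIn ℤ i k := by
  have h := b.coe_rootForm i (b.latticeCoroot k)
  rw [latticeCoroot, P.root'_coroot_eq_pairing, ← P.algebraMap_pairingIn ℤ, eq_intCast] at h
  exact_mod_cast h

lemma latticeCoroot_mem (k : ι) : b.latticeCoroot k ∈ b.corootSublattice :=
  Submodule.subset_span ⟨k, rfl⟩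

lemma exists_eq_sum_latticeCoroot {x : b.coweightLattice} (hx : x ∈ b.corootSublattice) :
    ∃ n : b.support → ℤ, x = ∑ j : b.support, n j • b.latticeCoroot j := by
  have h : (x : N) ∈ Submodule.span ℤ (P.coroot '' b.support) := by
    rw [b.span_int_coroot_support]; exact hx
  rw [Set.image_eq_range, Submodule.mem_span_range_iff_exists_fun] at h
  obtain ⟨n, hn⟩ := h
  refine ⟨n, Subtype.ext ?_⟩
  rw [← hn]
  simp [latticeCoroot]

end Coroots

/-! ### The Weyl group acting on coweights -/

section WeylAction

lemma root'_coweightMap (w : P.weylGroup) (i : ι) (x : N) :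
    P.root' i ((w : P.Aut).toHom.coweightMap x) = P.root' (P.weylGroupToPerm w i) x := by
  have h := LinearMap.congr_fun (Hom.weight_coweight_transpose_apply P P x (w : P.Aut).toHom)
    (P.root i)
  have h' : (w : P.Aut).toHom.weightMap (P.root i) = P.root (P.weylGroupToPerm w i) :=
    Hom.root_weightMap_apply _ _ _ _
  rw [LinearMap.dualMap_apply, h'] at h
  exact h.symm

/-- The (right) action of the Weyl group on the coweight lattice: `coweightAct w` is the transpose
of the action of `w` on the root lattice. -/
def coweightAct (w : P.weylGroup) : b.coweightLattice →ₗ[ℤ] b.coweightLattice :=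
  ((w : P.Aut).toHom.coweightMap.restrictScalars ℤ).restrict (fun x hx i _ => by
    obtain ⟨m, hm⟩ := b.exists_int_root'_eq (P.weylGroupToPerm w i) ⟨x, hx⟩
    exact ⟨m, hm ▸ root'_coweightMap w i x⟩)

@[simp]
lemma rootForm_coweightAct (w : P.weylGroup) (i : ι) (x : b.coweightLattice) :
    b.rootForm i (b.coweightAct w x) = b.rootForm (P.weylGroupToPerm w i) x := by
  have h : (b.rootForm i (b.coweightAct w x) : ℝ) = b.rootForm (P.weylGroupToPerm w i) x := by
    rw [coe_rootForm, coe_rootForm]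
    exact root'_coweightMap w i x
  exact_mod_cast h

lemma coweightAct_mul (v w : P.weylGroup) (x : b.coweightLattice) :
    b.coweightAct (v * w) x = b.coweightAct w (b.coweightAct v x) := rfl

@[simp]
lemma coweightAct_one (x : b.coweightLattice) : b.coweightAct 1 x = x := rfl

lemma coweightAct_inv_coweightAct (w : P.weylGroup) (x : b.coweightLattice) :
    b.coweightAct w⁻¹ (b.coweightAct w x) = x := by
  rw [← coweightAct_mul, mul_inv_cancel, coweightAct_one]

lemma weylGroupToPerm_neg (w : P.weylGroup) {i k : ι} (h : P.root k = -P.root i) :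
    P.root (P.weylGroupToPerm w k) = -P.root (P.weylGroupToPerm w i) := by
  rw [← P.weylGroup_apply_root, ← P.weylGroup_apply_root, h, smul_neg]

lemma weylGroupToPerm_ofIdx (i : ι) :
    P.weylGroupToPerm (weylGroup.ofIdx P i) = P.reflectionPerm i := rfl

variable [P.IsCrystallographic]

lemma coweightAct_ofIdx (k : ι) (x : b.coweightLattice) :
    b.coweightAct (weylGroup.ofIdx P k) x = x - b.rootForm k x • b.latticeCoroot k := by
  apply Subtype.ext
  have h : ((b.coweightAct (weylGroup.ofIdx P k) x : b.coweightLattice) : N) =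
    P.coreflection k x := rfl
  rw [h, P.coreflection_apply, ← b.coe_rootForm]
  simp [latticeCoroot, Int.cast_smul_eq_zsmul]

/-- A reflection subtracts an integer multiple of a coroot, so the Weyl group acts trivially modulo
the coroot lattice. -/
lemma coweightAct_sub_mem (w : P.weylGroup) (x : b.coweightLattice) :
    b.coweightAct w x - x ∈ b.corootSublattice := by
  obtain ⟨w, hw⟩ := w
  induction hw using weylGroup.induction generalizing x with
  | mem i =>
    have h := b.coweightAct_ofIdx i x
    rw [weylGroup.ofIdx] at h
    rw [h, sub_sub_cancel_left, neg_mem_iff]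
    exact zsmul_mem (b.latticeCoroot_mem i) _
  | one =>
    have h : b.coweightAct ⟨1, one_mem _⟩ x = x := rfl
    rw [h, sub_self]
    exact zero_mem _
  | mul g₁ g₂ hg₁ hg₂ h₁ h₂ =>
    have h := b.coweightAct_mul ⟨g₁, hg₁⟩ ⟨g₂, hg₂⟩ x
    rw [Submonoid.mk_mul_mk _ g₁ g₂ hg₁ hg₂] at h
    rw [h, ← sub_add_sub_cancel _ (b.coweightAct ⟨g₁, hg₁⟩ x)]
    exact add_mem (h₂ _) (h₁ _)

end WeylAction

end RootPairing.Base
end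

noncomputable section

namespace RootPairing.Base

/-! ### Simple reflections, exchange and freeness -/

section SimpleTransitivity

variable {ι M N : Type*} [AddCommGroup M] [Module ℝ M] [AddCommGroup N] [Module ℝ N]
  {P : RootPairing ι ℝ M N} (b : P.Base)

lemma conj_ofIdx (w : P.weylGroup) (k : ι) :
    w * weylGroup.ofIdx P k = weylGroup.ofIdx P (P.weylGroupToPerm w k) * w := by
  apply Subtype.ext
  apply RootPairing.Equiv.coweightHom_injective P
  apply MulOpposite.unop_injective
  refine LinearEquiv.ext fun x => ?_
  have h : (w : P.Aut).toHom.coweightMap (P.coroot (P.weylGroupToPerm w k)) = P.coroot k := by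
    rw [Hom.coroot_coweightMap_apply]
    congr 1
    exact Equiv.symm_apply_apply _ _
  have h1 := P.coreflection_apply k ((w : P.Aut).toHom.coweightMap x)
  have h2 := congrArg (w : P.Aut).toHom.coweightMap
    (P.coreflection_apply (P.weylGroupToPerm w k) x)
  rw [map_sub, map_smul, h] at h2
  rw [root'_coweightMap] at h1
  exact h1.trans h2.symm

lemma ofIdx_mul_self (k : ι) : weylGroup.ofIdx P k * weylGroup.ofIdx P k = 1 := by
  apply Subtype.ext
  exact (mul_eq_one_iff_inv_eq.mpr (Equiv.reflection_inv P k))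

/-- The product of the simple reflections in a word. -/
def wordProd (l : List b.support) : P.weylGroup :=
  (l.map fun i => weylGroup.ofIdx P i).prod

lemma wordProd_cons (i : b.support) (l : List b.support) :
    b.wordProd (i :: l) = weylGroup.ofIdx P i * b.wordProd l := by
  simp [wordProd]

variable [Finite ι] [P.IsCrystallographic] [P.IsReduced]

lemma closure_ofIdx_support :
    Subgroup.closure (Set.range fun i : b.support => weylGroup.ofIdx P i) = ⊤ := by
  have key (i : ι) : weylGroup.ofIdx P i ∈
      Subgroup.closure (Set.range fun i : b.support => weylGroup.ofIdx P i) := by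
    have hconj (i j : ι) : weylGroup.ofIdx P (P.reflectionPerm j i) =
        weylGroup.ofIdx P j * weylGroup.ofIdx P i * weylGroup.ofIdx P j := by
      rw [conj_ofIdx (weylGroup.ofIdx P j) i, mul_assoc, ofIdx_mul_self, mul_one]
      rfl
    have hsimple (j : ι) (hj : j ∈ b.support) : weylGroup.ofIdx P j ∈
        Subgroup.closure (Set.range fun i : b.support => weylGroup.ofIdx P i) :=
      Subgroup.subset_closure ⟨⟨j, hj⟩, rfl⟩
    refine b.induction_reflect i (fun i hi => ?_)
      hsimple (fun i j hi hj => ?_)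
    · rw [hconj]; exact mul_mem (mul_mem hi hi) hi
    · rw [hconj]; exact mul_mem (mul_mem (hsimple j hj) hi) (hsimple j hj)
  refine eq_top_iff.mpr fun w _ => ?_
  obtain ⟨w, hw⟩ := w
  induction hw using weylGroup.induction with
  | mem i => exact key i
  | one => exact one_mem _
  | mul g₁ g₂ hg₁ hg₂ h₁ h₂ =>
    rw [← Submonoid.mk_mul_mk _ g₁ g₂ hg₁ hg₂]
    exact mul_mem (h₁ trivial) (h₂ trivial)

lemma wordProd_surjective : Function.Surjective b.wordProd := by
  intro w
  have hw : w ∈ Subgroup.closure (Set.range fun i : b.support => weylGroup.ofIdx P i) := by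
    rw [closure_ofIdx_support]; trivial
  induction hw using Subgroup.closure_induction_left with
  | one => exact ⟨[], rfl⟩
  | mul_left x hx y hy ih =>
    obtain ⟨i, rfl⟩ := hx
    obtain ⟨l, rfl⟩ := ih
    exact ⟨i :: l, b.wordProd_cons i l⟩
  | inv_mul_cancel x hx y hy ih =>
    obtain ⟨i, rfl⟩ := hx
    obtain ⟨l, rfl⟩ := ih
    refine ⟨i :: l, ?_⟩
    rw [wordProd_cons, inv_eq_of_mul_eq_one_left (ofIdx_mul_self (P := P) i)]

/-- The exchange property. -/
lemma exists_wordProd_eq_mul_ofIdx (l : List b.support) (k : b.support)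
    (h : ¬ b.IsPos (P.weylGroupToPerm (b.wordProd l) k)) :
    ∃ l' : List b.support, l'.length < l.length ∧
      b.wordProd l' = b.wordProd l * weylGroup.ofIdx P k := by
  induction l with
  | nil => exact absurd (b.isPos_of_mem_support k.2) h
  | cons i t ih =>
    by_cases ht : b.IsPos (P.weylGroupToPerm (b.wordProd t) k)
    · refine ⟨t, by simp, ?_⟩
      -- A simple reflection makes only its own positive root negative. Hence `t` carries `k` to
      -- `i`, and conjugation cancels the letter `i`.
      have hi : P.weylGroupToPerm (b.wordProd t) k = i := by
        by_contra hne
        refine h ?_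
        rw [wordProd_cons, map_mul]
        exact ht.reflectionPerm i.2 hne
      rw [wordProd_cons, mul_assoc, conj_ofIdx, hi, ← mul_assoc, ofIdx_mul_self, one_mul]
    · obtain ⟨l', hl', h'⟩ := ih ht
      refine ⟨i :: l', by simpa using hl', ?_⟩
      rw [wordProd_cons, wordProd_cons, h', mul_assoc]

/-- The Weyl group acts freely on the set of positive systems. -/
lemma eq_one_of_forall_isPos {w : P.weylGroup}
    (hw : ∀ i ∈ b.support, b.IsPos (P.weylGroupToPerm w i)) : w = 1 := by
  obtain ⟨l, hl⟩ := b.wordProd_surjective w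
  induction hn : l.length using Nat.strong_induction_on generalizing l with
  | _ n ih =>
  rcases List.eq_nil_or_concat' l with rfl | ⟨t, k, rfl⟩
  · exact hl.symm
  have hprod : w = b.wordProd t * weylGroup.ofIdx P k := by
    rw [← hl]; simp [wordProd]
  -- Since `w` keeps the last letter `k` positive, the prefix `t` makes it negative; exchange then
  -- gives a word for `w` shorter than `t`.
  have hneg : ¬ b.IsPos (P.weylGroupToPerm (b.wordProd t) k) := by
    have h := hw k k.2
    have hk : P.root (P.weylGroupToPerm w k) = -P.root (P.weylGroupToPerm (b.wordProd t) k) := by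
      rw [hprod, map_mul]
      exact weylGroupToPerm_neg _ (by rw [weylGroupToPerm_ofIdx]; simp)
    intro h'
    have h1 := b.rootCoeff_neg hk
    have h2 := h.rootCoeff_nonneg
    obtain ⟨j, hj⟩ := h'.exists_rootCoeff_pos
    have h3 := h2 j
    rw [h1] at h3
    simp only [Pi.zero_apply, Pi.neg_apply] at h3
    lia
  obtain ⟨l', hlen, hl'⟩ := b.exists_wordProd_eq_mul_ofIdx t k hneg
  refine ih l'.length ?_ l' (hl'.trans hprod.symm) rfl
  rw [← hn, List.length_append]
  lia

end SimpleTransitivity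

end RootPairing.Base
end

noncomputable section

namespace RootPairing.Base

variable {ι M N : Type*} [AddCommGroup M] [Module ℝ M] [AddCommGroup N] [Module ℝ N]
  {P : RootPairing ι ℝ M N} (b : P.Base)

lemma coweightAct_mem_corootSublattice [P.IsCrystallographic] (w : P.weylGroup)
    {x : b.coweightLattice} (hx : x ∈ b.corootSublattice) : b.coweightAct w x ∈ b.corootSublattice := by
  simpa using add_mem (b.coweightAct_sub_mem w x) hx

/-! ### The invariant form and small coroot vectors -/

section Form

variable [Fintype ι]

/-- The canonical Weyl-invariant form on the coweight lattice. -/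
def coweightForm (x y : b.coweightLattice) : ℤ := ∑ i, b.rootForm i x * b.rootForm i y

lemma coweightForm_comm (x y : b.coweightLattice) : b.coweightForm x y = b.coweightForm y x :=
  Finset.sum_congr rfl fun _ _ => mul_comm _ _

lemma coweightForm_sub_left (x y z : b.coweightLattice) :
    b.coweightForm (x - y) z = b.coweightForm x z - b.coweightForm y z := by
  simp [coweightForm, sub_mul]

lemma coweightForm_sub_right (x y z : b.coweightLattice) :
    b.coweightForm z (x - y) = b.coweightForm z x - b.coweightForm z y := by
  simp [coweightForm, mul_sub]

lemma coweightForm_smul_left (c : ℤ) (x y : b.coweightLattice) :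
    b.coweightForm (c • x) y = c * b.coweightForm x y := by
  simp [coweightForm, Finset.mul_sum, mul_assoc]

lemma coweightForm_smul_right (c : ℤ) (x y : b.coweightLattice) :
    b.coweightForm x (c • y) = c * b.coweightForm x y := by
  rw [coweightForm_comm, coweightForm_smul_left, coweightForm_comm]

lemma coweightForm_sum_right {κ : Type*} (s : Finset κ) (x : b.coweightLattice)
    (y : κ → b.coweightLattice) :
    b.coweightForm x (∑ j ∈ s, y j) = ∑ j ∈ s, b.coweightForm x (y j) := by
  simp only [coweightForm, map_sum, Finset.mul_sum]
  exact Finset.sum_comm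

lemma coweightForm_coweightAct (w : P.weylGroup) (x y : b.coweightLattice) :
    b.coweightForm (b.coweightAct w x) (b.coweightAct w y) = b.coweightForm x y := by
  simp_rw [coweightForm, rootForm_coweightAct]
  exact Equiv.sum_comp (P.weylGroupToPerm w) fun i => b.rootForm i x * b.rootForm i y

lemma coweightForm_self_nonneg (x : b.coweightLattice) : 0 ≤ b.coweightForm x x :=
  Finset.sum_nonneg fun _ _ => mul_self_nonneg _

lemma coweightForm_self_pos [P.IsRootSystem] {x : b.coweightLattice} (hx : x ≠ 0) :
    0 < b.coweightForm x x := by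
  obtain ⟨j, hj⟩ : ∃ j : b.support, b.rootForm j x ≠ 0 := by
    by_contra! h
    exact hx (coweightLattice_ext fun j => by rw [h j, map_zero])
  exact Finset.sum_pos' (fun _ _ => mul_self_nonneg _)
    ⟨j, Finset.mem_univ _, mul_self_pos.mpr hj⟩

variable [P.IsCrystallographic]

/-- This is invariance of the form under the reflection in `k`, expanded. -/
lemma two_mul_coweightForm_latticeCoroot (k : ι) (x : b.coweightLattice) :
    2 * b.coweightForm x (b.latticeCoroot k) =
      b.rootForm k x * b.coweightForm (b.latticeCoroot k) (b.latticeCoroot k) := by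
  have h := b.coweightForm_coweightAct (weylGroup.ofIdx P k) x (b.latticeCoroot k)
  simp only [coweightAct_ofIdx, rootForm_latticeCoroot, pairingIn_same, coweightForm_sub_left,
    coweightForm_sub_right, coweightForm_smul_left, coweightForm_smul_right] at h
  linarith

lemma coweightForm_latticeCoroot_pos (k : ι) :
    0 < b.coweightForm (b.latticeCoroot k) (b.latticeCoroot k) :=
  Finset.sum_pos' (fun _ _ => mul_self_nonneg _)
    ⟨k, Finset.mem_univ _, mul_self_pos.mpr (by simp)⟩

/-- Reflection in an affine hyperplane brings `x` closer to `y` when the hyperplane strictly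
separates them; this drives the descent into the alcove. -/
lemma coweightForm_sub_smul_latticeCoroot (k : ι) (c e : ℤ) (x y : b.coweightLattice)
    (hc : c = b.rootForm k x - e) :
    b.coweightForm (x - c • b.latticeCoroot k - y) (x - c • b.latticeCoroot k - y) =
      b.coweightForm (x - y) (x - y) +
        b.coweightForm (b.latticeCoroot k) (b.latticeCoroot k) * (c * (b.rootForm k y - e)) := by
  have h := b.two_mul_coweightForm_latticeCoroot k (x - y)
  rw [map_sub] at h
  rw [sub_right_comm]
  generalize x - y = z at h ⊢
  rw [coweightForm_sub_left, coweightForm_sub_right, coweightForm_sub_right]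
  simp only [coweightForm_smul_left, coweightForm_smul_right]
  rw [b.coweightForm_comm (b.latticeCoroot k) z]
  linear_combination (-c) * h +
    c * b.coweightForm (b.latticeCoroot k) (b.latticeCoroot k) * hc

/-- The coroot lattice contains no minuscule coweight. -/
lemma eq_zero_of_mem_corootSublattice [P.IsRootSystem] {x : b.coweightLattice}
    (hx : x ∈ b.corootSublattice) (h : ∀ i, |b.rootForm i x| ≤ 1) : x = 0 := by
  classical
  obtain ⟨n, hn⟩ := b.exists_eq_sum_latticeCoroot hx
  clear hx
  induction hN : ∑ j, (n j).natAbs using Nat.strong_induction_on generalizing x n with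
  | _ k ih =>
  by_contra hx0
  -- Up to a factor two this is the norm of `x`, so some `n j` has the same sign as the value of the
  -- `j`-th simple root on `x`.
  have hpos : 0 < ∑ j : b.support, n j * (b.rootForm j x *
      b.coweightForm (b.latticeCoroot j) (b.latticeCoroot j)) := by
    simp_rw [← two_mul_coweightForm_latticeCoroot]
    have hsum : ∑ j : b.support, n j * (2 * b.coweightForm x (b.latticeCoroot j)) =
        2 * b.coweightForm x x := by
      have h' : b.coweightForm x x =
          b.coweightForm x (∑ j : b.support, n j • b.latticeCoroot j) := by rw [← hn]
      rw [h', coweightForm_sum_right, Finset.mul_sum]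
      simp_rw [coweightForm_smul_right, mul_left_comm]
    rw [hsum]
    have := b.coweightForm_self_pos hx0
    lia
  obtain ⟨j, -, hj⟩ : ∃ j ∈ Finset.univ, 0 < n j * (b.rootForm j x *
      b.coweightForm (b.latticeCoroot j) (b.latticeCoroot j)) := by
    by_contra! hle
    exact absurd hpos (not_lt.mpr (Finset.sum_nonpos hle))
  rw [← mul_assoc] at hj
  have hj' := (mul_pos_iff_of_pos_right (b.coweightForm_latticeCoroot_pos j)).mp hj
  set e := b.rootForm j x with he
  have he1 := abs_le.mp (h j)
  rw [← he] at he1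
  have hcases : e = 1 ∧ 0 < n j ∨ e = -1 ∧ n j < 0 := by
    obtain he0 | he0 | he0 : e = 0 ∨ e = 1 ∨ e = -1 := by lia
    · rw [he0, mul_zero] at hj'; exact absurd hj' (lt_irrefl 0)
    · rw [he0] at hj'; lia
    · rw [he0] at hj'; lia
  have hact := b.coweightAct_ofIdx j x
  rw [← he] at hact
  -- Reflecting in `j` lowers `|n j|` by one and only permutes the root values. The resulting zero
  -- forces `x` to be `e` times a coroot, where the root takes the value `2e` instead of `e`.
  have hx' : x - e • b.latticeCoroot j = 0 := by
    refine ih _ ?_ (fun i => ?_) (n - e • Pi.single j 1) ?_ rfl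
    · rw [← hN]
      refine Finset.sum_lt_sum (fun l _ => ?_) ⟨j, Finset.mem_univ _, ?_⟩
      · rcases eq_or_ne l j with rfl | hl
        · simp only [Pi.sub_apply, Pi.smul_apply, Pi.single_eq_same, smul_eq_mul, mul_one]
          lia
        · simp [Pi.single_eq_of_ne hl]
      · simp only [Pi.sub_apply, Pi.smul_apply, Pi.single_eq_same, smul_eq_mul, mul_one]
        lia
    · rw [← hact, rootForm_coweightAct]; exact h _
    · conv_lhs => rw [hn]
      simp [sub_smul, Finset.sum_sub_distrib, Pi.single_apply]
  have h2 := congrArg (b.rootForm j) hx'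
  rw [map_sub, map_zsmul, rootForm_latticeCoroot, pairingIn_same, ← he] at h2
  simp only [smul_eq_mul, map_zero] at h2
  lia

end Form

/-! ### Affine Weyl group and open alcove -/

section Alcove

variable [Finite ι] [Nonempty ι]

/-- The coweights in the interior of the `m`-fold dilation of the fundamental alcove. -/
def openAlcove (m : ℤ) : Set b.coweightLattice :=
  {u | (∀ j : b.support, 0 < b.rootForm j u) ∧ b.rootForm b.highestRoot u < m}

/-- The affine Weyl group moves every point off the walls into the open alcove. -/
lemma exists_mem_openAlcove [P.IsCrystallographic] [P.IsRootSystem] {m : ℤ}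
    (hm : b.height b.highestRoot < m) (z : b.coweightLattice)
    (hz : ∀ i, ¬ m ∣ b.rootForm i z) :
    ∃ w : P.weylGroup, ∃ x ∈ b.corootSublattice, b.coweightAct w z + m • x ∈ b.openAlcove m := by
  have := Fintype.ofFinite ι
  induction hN : (b.coweightForm (z - b.rhoCheck) (z - b.rhoCheck)).toNat using
    Nat.strong_induction_on generalizing z with
  | _ n ih =>
  by_cases hzm : z ∈ b.openAlcove m
  · exact ⟨1, 0, zero_mem _, by simpa using hzm⟩
  -- By `hm` the point `rhoCheck` lies in the open alcove, so a wall at level `m * e` separates it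
  -- from `z`.
  obtain ⟨k, e, hke⟩ : ∃ k : ι, ∃ e : ℤ,
      (b.rootForm k z - m * e) * (b.height k - m * e) < 0 := by
    simp only [openAlcove, Set.mem_ofPred_eq, not_and_or, not_forall, not_lt] at hzm
    rcases hzm with ⟨j, hj⟩ | h
    · refine ⟨j, 0, ?_⟩
      have h0 : b.rootForm j z ≠ 0 := fun h => hz j (h ▸ dvd_zero m)
      rw [height_one_of_mem_support j.2]
      lia
    · refine ⟨b.highestRoot, 1, mul_neg_of_pos_of_neg ?_ (by lia)⟩
      have h0 : b.rootForm b.highestRoot z ≠ m := fun h => hz b.highestRoot (h ▸ dvd_refl _)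
      lia
  have hz' : z - (b.rootForm k z - m * e) • b.latticeCoroot k =
      b.coweightAct (weylGroup.ofIdx P k) z + m • (e • b.latticeCoroot k) := by
    rw [coweightAct_ofIdx, sub_smul, mul_smul]; abel
  have hform := b.coweightForm_sub_smul_latticeCoroot k _ (m * e) z b.rhoCheck rfl
  rw [rootForm_rhoCheck] at hform
  have hlt := mul_neg_of_pos_of_neg (b.coweightForm_latticeCoroot_pos k) hke
  have hnn := b.coweightForm_self_nonneg
    (z - (b.rootForm k z - m * e) • b.latticeCoroot k - b.rhoCheck)
  obtain ⟨w, x, hx, hw⟩ := ih _ (by rw [← hN]; lia)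
    (z - (b.rootForm k z - m * e) • b.latticeCoroot k) (fun i => by
      rw [hz', map_add, rootForm_coweightAct, map_zsmul, smul_eq_mul, dvd_add_left ⟨_, rfl⟩]
      exact hz _) rfl
  refine ⟨weylGroup.ofIdx P k * w, b.coweightAct w (e • b.latticeCoroot k) + x,
    add_mem (b.coweightAct_mem_corootSublattice w (zsmul_mem (b.latticeCoroot_mem k) e)) hx, ?_⟩
  rw [hz', map_add, map_zsmul, add_assoc, ← smul_add] at hw
  exact hw

variable {b}

lemma IsPos.rootForm_pos {i : ι} (hi : b.IsPos i) {m : ℤ} {u : b.coweightLattice}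
    (hu : u ∈ b.openAlcove m) : 0 < b.rootForm i u := by
  obtain ⟨j, hj⟩ := hi.exists_rootCoeff_pos
  rw [b.rootForm_eq_sum_rootCoeff]
  exact Finset.sum_pos' (fun l _ => mul_nonneg (hi.rootCoeff_nonneg l) (hu.1 l).le)
    ⟨j, Finset.mem_univ _, mul_pos hj (hu.1 j)⟩

lemma isPos_of_rootForm_pos {i : ι} {m : ℤ} {u : b.coweightLattice}
    (hu : u ∈ b.openAlcove m) (hi : 0 < b.rootForm i u) : b.IsPos i := by
  by_contra h
  rw [b.rootForm_eq_sum_rootCoeff] at hi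
  exact absurd hi (not_lt.mpr (Finset.sum_nonpos fun l _ =>
    mul_nonpos_of_nonpos_of_nonneg (b.rootCoeff_nonpos_of_not_isPos h l) (hu.1 l).le))

variable [P.IsCrystallographic] [P.IsReduced] [P.IsIrreducible]

lemma abs_rootForm_lt (i : ι) {m : ℤ} {u : b.coweightLattice}
    (hu : u ∈ b.openAlcove m) : |b.rootForm i u| < m := by
  have hlt (i : ι) : b.rootForm i u < m := by
    refine lt_of_le_of_lt ?_ hu.2
    rw [b.rootForm_eq_sum_rootCoeff i, b.rootForm_eq_sum_rootCoeff b.highestRoot]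
    exact Finset.sum_le_sum fun j _ =>
      mul_le_mul_of_nonneg_right (b.rootCoeff_le_highestRoot i j) (hu.1 j).le
  have hneg := b.rootForm_neg (i := i) (k := P.reflectionPerm i i) (by simp) u
  have := hlt (P.reflectionPerm i i)
  exact abs_lt.mpr ⟨by lia, hlt i⟩

/-- Distinct elements of the affine Weyl group move the open alcove to disjoint sets. -/
lemma eq_one_of_mem_openAlcove {m : ℤ} {u : b.coweightLattice} {w : P.weylGroup}
    {x : b.coweightLattice} (hx : x ∈ b.corootSublattice) (hu : u ∈ b.openAlcove m)
    (hu' : b.coweightAct w u + m • x ∈ b.openAlcove m) : w = 1 ∧ x = 0 := by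
  have := Fintype.ofFinite ι
  have hx0 : x = 0 := by
    refine b.eq_zero_of_mem_corootSublattice hx fun i => ?_
    have h1 := abs_lt.mp (abs_rootForm_lt (P.weylGroupToPerm w i) hu)
    have h2 := abs_lt.mp (abs_rootForm_lt i hu')
    rw [map_add, rootForm_coweightAct, map_zsmul, smul_eq_mul] at h2
    have hm : 0 < m := by lia
    -- Root values on both points are below `m` in absolute value, so those on `x` are at most one
    -- and `x` vanishes.
    have h3 : m * b.rootForm i x < m * 2 := by lia
    have h4 : m * (-2) < m * b.rootForm i x := by lia
    have := lt_of_mul_lt_mul_left h3 hm.le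
    have := lt_of_mul_lt_mul_left h4 hm.le
    exact abs_le.mpr ⟨by lia, by lia⟩
  refine ⟨b.eq_one_of_forall_isPos fun i hi => isPos_of_rootForm_pos hu ?_, hx0⟩
  rw [← rootForm_coweightAct]
  have := (b.isPos_of_mem_support hi).rootForm_pos hu'
  rwa [hx0, smul_zero, add_zero] at this

end Alcove

end RootPairing.Base
end

noncomputable section

namespace RootPairing.Base

variable {ι M N : Type*} [AddCommGroup M] [Module ℝ M] [AddCommGroup N] [Module ℝ N]
  {P : RootPairing ι ℝ M N} (b : P.Base) [Finite ι] [Nonempty ι]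

/-! ### Affine forms on the walls -/

section ExtendedForm

/-- The affine form `αⱼ + q δ_{j, 0}` vanishing on the `j`-th wall of the `q`-fold dilation of the
fundamental alcove. -/
def extendedForm (q : ℤ) (j : Option b.support) (x : b.coweightLattice) : ℤ :=
  b.rootForm (b.extendedRoot j) x + if j = none then q else 0

@[simp]
lemma extendedForm_some (q : ℤ) (j : b.support) (x : b.coweightLattice) :
    b.extendedForm q (some j) x = b.rootForm j x := by
  simp [extendedForm, extendedRoot]

@[simp]
lemma extendedForm_none (q : ℤ) (x : b.coweightLattice) :
    b.extendedForm q none x = q - b.rootForm b.highestRoot x := by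
  have h := b.rootForm_neg b.root_extendedRoot_none x
  simp only [extendedForm, if_true]
  lia

lemma mem_openAlcove_iff {m : ℤ} {u : b.coweightLattice} :
    u ∈ b.openAlcove m ↔ ∀ j, 0 < b.extendedForm m j u := by
  simp [Option.forall, openAlcove, and_comm]

lemma rootForm_highestRoot_eq_sum (x : b.coweightLattice) :
    b.rootForm b.highestRoot x = ∑ j : b.support, b.extendedCoeff (some j) * b.rootForm j x := by
  simp_rw [coe_extendedCoeff_some]
  exact b.rootForm_eq_sum_rootCoeff _ x

/-- The relation `∑ cⱼ αⱼ = 0` in the extended base leaves only the constant `q`. -/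
lemma sum_extendedCoeff_mul_extendedForm (q : ℤ) (x : b.coweightLattice) :
    ∑ j, b.extendedCoeff j * b.extendedForm q j x = q := by
  rw [Fintype.sum_option]
  simp only [extendedForm_none, extendedForm_some]
  rw [← rootForm_highestRoot_eq_sum]
  simp [extendedCoeff]

lemma abs_height_lt (i : ι) : |b.height i| < b.height b.highestRoot + 1 := by
  have h : b.height (P.reflectionPerm i i) = -b.height i := b.height_reflectionPerm_self i
  have h1 := b.height_le_height_highestRoot i
  have h2 := b.height_le_height_highestRoot (P.reflectionPerm i i)
  exact abs_lt.mpr ⟨by lia, by lia⟩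

end ExtendedForm

/-! ### Pairs as perturbed alcove points -/

section AlcovePairs

/-- Pairs of a Weyl group element `w` and a coweight `x` in the `q`-fold dilation of the closed
fundamental alcove, at distance more than `n` from the walls `αⱼ` with `w(αⱼ) > 0`. -/
def alcovePairs (n q : ℕ) : Set (P.weylGroup × b.coweightLattice) :=
  {p | ∀ j, 0 ≤ b.extendedForm q j p.2 ∧
    (b.IsPos (P.weylGroupToPerm p.1 (b.extendedRoot j)) → (n : ℤ) < b.extendedForm q j p.2)}

variable {b}

lemma extendedForm_perturb [P.IsRootSystem] (H : ℤ) (q : ℕ) (w : P.weylGroup)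
    (x : b.coweightLattice) (j : Option b.support) :
    b.extendedForm (H * q) j (H • x - b.coweightAct w b.rhoCheck) =
      H * b.extendedForm q j x - b.height (P.weylGroupToPerm w (b.extendedRoot j)) := by
  rw [extendedForm, extendedForm, map_sub, map_zsmul, rootForm_coweightAct, rootForm_rhoCheck,
    smul_eq_mul]
  split_ifs <;> ring

/-- The height of `w(αⱼ)` is nonzero and smaller than the scaling factor, so it matters only on the
wall, where it must be negative. -/
lemma mem_alcovePairs_zero_iff [P.IsRootSystem] {q : ℕ} {w : P.weylGroup}
    {x : b.coweightLattice} :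
    (w, x) ∈ b.alcovePairs 0 q ↔ (b.height b.highestRoot + 1) • x - b.coweightAct w b.rhoCheck ∈
      b.openAlcove ((b.height b.highestRoot + 1) * q) := by
  rw [mem_openAlcove_iff]
  refine forall_congr' fun j => ?_
  rw [extendedForm_perturb]
  have h1 := abs_lt.mp (b.abs_height_lt (P.weylGroupToPerm w (b.extendedRoot j)))
  have h2 := b.height_ne_zero (P.weylGroupToPerm w (b.extendedRoot j))
  rw [isPos_iff]
  dsimp only
  generalize b.height (P.weylGroupToPerm w (b.extendedRoot j)) = t at *
  generalize b.height b.highestRoot + 1 = H at *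
  generalize b.extendedForm q j x = a at *
  constructor
  · rintro ⟨ha, hpos⟩
    rcases ha.eq_or_lt with rfl | ha
    · simp only [Nat.cast_zero, lt_irrefl, imp_false] at hpos
      lia
    · nlinarith
  · intro h
    have ha : 0 ≤ a := by
      by_contra! ha
      nlinarith
    refine ⟨ha, fun ht => ?_⟩
    rcases ha.eq_or_lt with rfl | ha
    · lia
    · exact_mod_cast ha

variable [P.IsCrystallographic]

lemma exists_mem_alcovePairs [P.IsRootSystem] {q : ℕ} (hq : 0 < q) (y z : b.coweightLattice) :
    ∃ p ∈ b.alcovePairs 0 q, ∃ x ∈ b.corootSublattice,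
      p.2 = b.coweightAct p.1 y + (q : ℤ) • (z + x) := by
  set H := b.height b.highestRoot + 1 with hH
  have hθ : 0 < b.height b.highestRoot := b.isPos_highestRoot
  have hm : b.height b.highestRoot < H * q := by
    have : (1 : ℤ) ≤ q := by exact_mod_cast hq
    nlinarith
  obtain ⟨w, x, hx, hw⟩ := b.exists_mem_openAlcove hm (H • (y + (q : ℤ) • z) - b.rhoCheck)
    (fun i hi => by
      rw [map_sub, rootForm_rhoCheck, map_zsmul, smul_eq_mul] at hi
      -- Modulo `H` only the term from `rhoCheck` survives.
      have h1 : H ∣ b.height i :=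
        (dvd_sub_right (dvd_mul_right _ _)).mp (dvd_trans (dvd_mul_right _ _) hi)
      exact b.height_ne_zero i (Int.eq_zero_of_abs_lt_dvd h1 (b.abs_height_lt i)))
  refine ⟨(w, b.coweightAct w y + (q : ℤ) • (z + (b.coweightAct w z - z + x))), ?_,
    b.coweightAct w z - z + x, add_mem (b.coweightAct_sub_mem w z) hx, rfl⟩
  rw [mem_alcovePairs_zero_iff, ← hH]
  convert hw using 1
  rw [map_sub, map_zsmul, map_add, map_zsmul, mul_smul]
  module

lemma eq_of_mem_alcovePairs [P.IsReduced] [P.IsIrreducible] {q : ℕ} {y z : b.coweightLattice}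
    {p p' : P.weylGroup × b.coweightLattice} (hp : p ∈ b.alcovePairs 0 q)
    (hp' : p' ∈ b.alcovePairs 0 q) {x x' : b.coweightLattice} (hx : x ∈ b.corootSublattice)
    (hx' : x' ∈ b.corootSublattice) (h : p.2 = b.coweightAct p.1 y + (q : ℤ) • (z + x))
    (h' : p'.2 = b.coweightAct p'.1 y + (q : ℤ) • (z + x')) : p = p' := by
  obtain ⟨v, s⟩ := p
  obtain ⟨w, t⟩ := p'
  dsimp only at h h'
  rw [mem_alcovePairs_zero_iff] at hp hp'
  set H := b.height b.highestRoot + 1 with hH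
  -- The translation, up to `H * q`, of the affine element carrying the perturbed point of the first
  -- pair to that of the second.
  set c := z + x - b.coweightAct (v⁻¹ * w) (z + x) + (x' - x) with hc
  have hcm : c ∈ b.corootSublattice := by
    refine add_mem ?_ (sub_mem hx' hx)
    rw [← neg_mem_iff, neg_sub]
    exact b.coweightAct_sub_mem _ _
  have heq : H • t - b.coweightAct w b.rhoCheck =
      b.coweightAct (v⁻¹ * w) (H • s - b.coweightAct v b.rhoCheck) + (H * q) • c := by
    have hvw (a : b.coweightLattice) :
        b.coweightAct (v⁻¹ * w) (b.coweightAct v a) = b.coweightAct w a := by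
      rw [← coweightAct_mul, mul_inv_cancel_left]
    rw [map_sub, hvw, map_zsmul, h, map_add, hvw, map_zsmul, h', hc, mul_smul]
    module
  rw [heq] at hp'
  obtain ⟨hvw, hc0⟩ := eq_one_of_mem_openAlcove hcm hp hp'
  obtain rfl : v = w := inv_mul_eq_one.mp hvw
  rw [hvw, coweightAct_one, sub_self, zero_add] at hc
  have : x' = x := sub_eq_zero.mp (hc.symm.trans hc0)
  rw [h, h', this]

variable (b)

/-- Positive roots need no `α₀`; a negative root is `α₀` plus the sum of itself and the highest
root. Domination by the highest root gives the bounds. -/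
lemma exists_coeff_extendedRoot [P.IsReduced] [P.IsIrreducible] (i : ι) :
    ∃ d : Option b.support → ℕ, (∀ j, d j ≤ b.extendedCoeff j) ∧
      ∀ x, b.rootForm i x = ∑ j, d j * b.rootForm (b.extendedRoot j) x := by
  by_cases hi : b.IsPos i
  · refine ⟨fun j => j.elim 0 fun j => (b.rootCoeff i j).toNat, ?_, fun x => ?_⟩
    · rintro (_ | j)
      · simp
      · have h1 := b.rootCoeff_le_highestRoot i j
        rw [← coe_extendedCoeff_some] at h1
        simpa using h1
    · rw [Fintype.sum_option, b.rootForm_eq_sum_rootCoeff i]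
      simp only [Option.elim_none, Nat.cast_zero, zero_mul, zero_add, Option.elim_some]
      refine Finset.sum_congr rfl fun j _ => ?_
      rw [Int.toNat_of_nonneg (hi.rootCoeff_nonneg j)]
      rfl
  · have hle (j : b.support) : b.rootCoeff i j ≤ 0 := b.rootCoeff_nonpos_of_not_isPos hi j
    have hge (j : b.support) : 0 ≤ b.extendedCoeff (some j) + b.rootCoeff i j := by
      have h1 := b.rootCoeff_le_highestRoot (P.reflectionPerm i i) j
      have h2 := b.rootCoeff_neg (i := i) (k := P.reflectionPerm i i) (by simp)
      rw [← coe_extendedCoeff_some, h2, Pi.neg_apply] at h1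
      lia
    refine ⟨fun j => j.elim 1 fun j => (b.extendedCoeff (some j) + b.rootCoeff i j).toNat, ?_,
      fun x => ?_⟩
    · rintro (_ | j)
      · simp [extendedCoeff]
      · simpa using hle j
    · rw [Fintype.sum_option, b.rootForm_eq_sum_rootCoeff i]
      simp only [Option.elim_none, Nat.cast_one, one_mul, Option.elim_some,
        Int.toNat_of_nonneg (hge _)]
      rw [b.rootForm_neg b.root_extendedRoot_none, rootForm_highestRoot_eq_sum]
      simp only [add_mul, Finset.sum_add_distrib]
      exact (neg_add_cancel_left _ _).symm

variable {b}

/-- Expand the root as `∑ dⱼ αⱼ` over the extended base. Since its image under `w` has positive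
height, some `dⱼ > 0` has `w(αⱼ) > 0`, and that wall gives the lower bound; `dⱼ ≤ cⱼ` gives the
upper one. -/
lemma lt_rootForm_of_mem_alcovePairs [P.IsReduced] [P.IsIrreducible] {n q : ℕ} {w : P.weylGroup}
    {x : b.coweightLattice} (hp : (w, x) ∈ b.alcovePairs n q) {i : ι}
    (hi : b.IsPos (P.weylGroupToPerm w i)) :
    ∃ e : ℤ, (n : ℤ) < b.rootForm i x + q * e ∧ b.rootForm i x + q * e ≤ q := by
  obtain ⟨d, hd, hsum⟩ := b.exists_coeff_extendedRoot i
  have hval : b.rootForm i x + q * d none = ∑ j, d j * b.extendedForm q j x := by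
    rw [hsum x]
    simp_rw [extendedForm, mul_add, Finset.sum_add_distrib]
    simp [mul_comm]
  refine ⟨d none, ?_, ?_⟩
  · rw [hval]
    have hheight := hsum (b.coweightAct w b.rhoCheck)
    simp only [rootForm_coweightAct, rootForm_rhoCheck] at hheight
    obtain ⟨j, -, hj⟩ : ∃ j ∈ Finset.univ,
        0 < (d j : ℤ) * b.height (P.weylGroupToPerm w (b.extendedRoot j)) := by
      by_contra! hle
      rw [isPos_iff, hheight] at hi
      exact absurd hi (not_lt.mpr (Finset.sum_nonpos hle))
    have hdj : 0 < (d j : ℤ) := by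
      rcases Nat.eq_zero_or_pos (d j) with h | h
      · simp [h] at hj
      · exact_mod_cast h
    have hpos := (hp j).2 ((pos_iff_pos_of_mul_pos hj).mp hdj)
    calc (n : ℤ) < b.extendedForm q j x := hpos
      _ ≤ d j * b.extendedForm q j x := le_mul_of_one_le_left (hp j).1 hdj
      _ ≤ _ := Finset.single_le_sum (f := fun j => (d j : ℤ) * b.extendedForm q j x)
        (fun j _ => mul_nonneg (Nat.cast_nonneg _) (hp j).1) (Finset.mem_univ j)
  · rw [hval]
    conv_rhs => rw [← b.sum_extendedCoeff_mul_extendedForm q x]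
    exact Finset.sum_le_sum fun j _ =>
      mul_le_mul_of_nonneg_right (by exact_mod_cast hd j) (hp j).1

/-- A pair lies off the walls of the Linial arrangement modulo `q` if and only if it keeps distance
more than `n` from the relevant walls of the alcove. -/
lemma mem_alcovePairs_iff [P.IsReduced] [P.IsIrreducible] {n q : ℕ} {w : P.weylGroup}
    {x y z : b.coweightLattice} (hp : (w, x) ∈ b.alcovePairs 0 q)
    (hx : x = b.coweightAct w y + (q : ℤ) • z) :
    (w, x) ∈ b.alcovePairs n q ↔
      ∀ H ∈ b.truncatedAffineWeyl 1 n, ¬ H.1 y ≡ H.2 [ZMOD q] := by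
  have hform (i : ι) : b.rootForm i x = b.rootForm (P.weylGroupToPerm w i) y +
      q * b.rootForm i z := by
    rw [hx, map_add, rootForm_coweightAct, map_zsmul, smul_eq_mul]
  constructor
  · rintro h ⟨-, k⟩ ⟨i, hi, rfl, hk1, hkn⟩ hmod
    dsimp only at hk1 hkn hmod
    obtain ⟨i, rfl⟩ := (P.weylGroupToPerm w).surjective i
    obtain ⟨e, h1, h2⟩ := lt_rootForm_of_mem_alcovePairs h hi
    obtain ⟨c, hc⟩ := hmod.dvd
    rw [hform] at h1 h2
    -- As `1 ≤ k ≤ n`, subtracting `k` would put a multiple of `q` strictly between `0` and `q`.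
    have h3 : 0 < (q : ℤ) * (b.rootForm i z + e - c) := by linarith
    have h4 : (q : ℤ) * (b.rootForm i z + e - c) < q * 1 := by linarith
    have hq : (0 : ℤ) ≤ q := Int.natCast_nonneg q
    have h5 := lt_of_mul_lt_mul_left h4 hq
    have hq' : (0 : ℤ) < q := hq.lt_of_ne fun h => by simp [← h] at h3
    have h6 := (pos_iff_pos_of_mul_pos h3).mp hq'
    lia
  · intro h j
    refine ⟨(hp j).1, fun hj => ?_⟩
    by_contra! hle
    have hpos := (hp j).2 hj
    dsimp only at hle hpos
    -- The forbidden level is the distance to the violated wall: positive by the condition for `n =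
    -- 0`, and at most `n`.
    refine h (b.rootForm (P.weylGroupToPerm w (b.extendedRoot j)), b.extendedForm q j x)
      ⟨_, hj, rfl, by exact_mod_cast hpos, hle⟩ ?_
    rw [Int.modEq_iff_dvd]
    dsimp only
    rw [extendedForm, hform, add_assoc, add_sub_cancel_left]
    refine dvd_add (dvd_mul_right _ _) ?_
    split_ifs <;> simp

end AlcovePairs

end RootPairing.Base
end

noncomputable section

/-! ### Residue classes and partition counts -/

section ModN

variable {L : Type*} [AddCommGroup L]

lemma ModN.mkQ_eq_mkQ_iff {q : ℕ} {x y : L} :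
    ModN.mkQ q x = ModN.mkQ q y ↔ ∃ z : L, x = y + (q : ℤ) • z := by
  have h : ModN.mkQ q x = ModN.mkQ q y ↔ x - y ∈ LinearMap.range (LinearMap.lsmul ℤ L q) :=
    Submodule.Quotient.eq _
  rw [h, LinearMap.mem_range]
  refine exists_congr fun z => ?_
  rw [LinearMap.lsmul_apply, eq_sub_iff_add_eq', eq_comm]

lemma ModN.mkQ_surjective (q : ℕ) : Function.Surjective (ModN.mkQ (G := L) q) :=
  Submodule.mkQ_surjective _

lemma mkQ_mem_modComplement_iff {A : Set (Module.Dual ℤ L × ℤ)} {q : ℕ} {y : L} :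
    ModN.mkQ q y ∈ modComplement A q ↔ ∀ H ∈ A, ¬ H.1 y ≡ H.2 [ZMOD q] := by
  refine ⟨fun h => h y rfl, fun h x hx H hH hmod => h H hH ?_⟩
  obtain ⟨z, rfl⟩ := ModN.mkQ_eq_mkQ_iff.mp hx
  refine Int.ModEq.trans ?_ hmod
  rw [map_add, map_zsmul, smul_eq_mul, Int.modEq_iff_dvd]
  simp

end ModN

/-- The number of ways of writing `s` as a sum of parts of sizes `c j`. -/
def partitionCount {κ : Type*} [Fintype κ] (c : κ → ℕ) (s : ℕ) : ℕ :=
  Nat.card {a : κ → ℕ // ∑ j, c j * a j = s}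

lemma finite_partitions {κ : Type*} [Fintype κ] {c : κ → ℕ} (hc : ∀ j, 0 < c j) (s : ℕ) :
    Finite {a : κ → ℕ // ∑ j, c j * a j = s} := by
  refine Set.Finite.subset (Set.Finite.pi' fun _ : κ => Set.finite_Iic s) fun a ha j => ?_
  calc a j ≤ c j * a j := Nat.le_mul_of_pos_left _ (hc j)
    _ ≤ ∑ j, c j * a j := Finset.single_le_sum (f := fun j => c j * a j)
      (fun _ _ => Nat.zero_le _) (Finset.mem_univ j)
    _ = s := ha

namespace RootPairing.Base

variable {ι M N : Type*} [AddCommGroup M] [Module ℝ M] [AddCommGroup N] [Module ℝ N]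
  {P : RootPairing ι ℝ M N} (b : P.Base) [Finite ι] [Nonempty ι]

/-! ### Counting pairs for each Weyl group element -/

section AlcovePoints

/-- Coweights in a dilated alcove, with prescribed lower bounds for the distances to the walls,
correspond to partitions. -/
def alcovePointsEquiv [P.IsRootSystem] (q : ℕ) (m : Option b.support → ℕ) :
    {x : b.coweightLattice // ∀ j, (m j : ℤ) ≤ b.extendedForm q j x} ≃
      {a : Option b.support → ℕ //
        ∑ j, b.extendedCoeff j * a j + ∑ j, b.extendedCoeff j * m j = q} where
  toFun x := ⟨fun j => (b.extendedForm q j x - m j).toNat, by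
    zify
    rw [← Finset.sum_add_distrib]
    refine (Finset.sum_congr rfl fun j _ => ?_).trans (b.sum_extendedCoeff_mul_extendedForm q x)
    rw [Int.toNat_of_nonneg (sub_nonneg.mpr (x.2 j))]
    ring⟩
  invFun a := ⟨b.coweightCoords.symm fun j => a.1 (some j) + m (some j), by
    have ha := a.2
    zify at ha
    rw [← Finset.sum_add_distrib, Fintype.sum_option] at ha
    rintro (_ | j)
    · rw [extendedForm_none, rootForm_highestRoot_eq_sum]
      simp only [rootForm_coweightCoords_symm, extendedCoeff, mul_add] at ha ⊢
      lia
    · simp⟩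
  left_inv x := by
    refine Subtype.ext (coweightLattice_ext fun j => ?_)
    have h := x.2 (some j)
    rw [extendedForm_some] at h
    rw [rootForm_coweightCoords_symm]
    dsimp only
    rw [extendedForm_some]
    lia
  right_inv a := by
    have ha := a.2
    zify at ha
    rw [← Finset.sum_add_distrib, Fintype.sum_option] at ha
    refine Subtype.ext (funext ?_)
    rintro (_ | j)
    · simp only [extendedForm_none, rootForm_highestRoot_eq_sum, rootForm_coweightCoords_symm]
      simp only [extendedCoeff, mul_add] at ha ⊢
      lia
    · simp

lemma ncard_smul_closedFundamentalAlcove [P.IsRootSystem] {q : ℕ} (hq : 0 < q) :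
    (((q : ℝ) • b.closedFundamentalAlcove) ∩ (b.coweightLattice : Set N)).ncard =
      partitionCount b.extendedCoeff q := by
  have hq' : (0 : ℝ) < q := by exact_mod_cast hq
  have hmem (x : b.coweightLattice) : (x : N) ∈ (q : ℝ) • b.closedFundamentalAlcove ↔
      ∀ j, ((0 : ℕ) : ℤ) ≤ b.extendedForm q j x := by
    rw [Set.mem_smul_set_iff_inv_smul_mem₀ hq'.ne']
    simp only [closedFundamentalAlcove, Set.mem_ofPred_eq, map_smul, smul_eq_mul, Option.forall,
      extendedForm_none, extendedForm_some, ← coe_rootForm]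
    rw [inv_mul_le_iff₀ hq', mul_one, and_comm]
    refine and_congr ?_ ⟨fun h j => ?_, fun h i hi => ?_⟩
    · rw [Nat.cast_zero, sub_nonneg]
      exact_mod_cast Iff.rfl
    · have := (mul_nonneg_iff_of_pos_left (inv_pos.mpr hq')).mp (h j j.2)
      exact_mod_cast this
    · refine (mul_nonneg_iff_of_pos_left (inv_pos.mpr hq')).mpr ?_
      exact_mod_cast h ⟨i, hi⟩
  have himage : ((q : ℝ) • b.closedFundamentalAlcove) ∩ (b.coweightLattice : Set N) =
      Subtype.val '' {x : b.coweightLattice | ∀ j, ((0 : ℕ) : ℤ) ≤ b.extendedForm q j x} := by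
    ext x
    constructor
    · rintro ⟨hx, hxL⟩
      exact ⟨⟨x, hxL⟩, (hmem ⟨x, hxL⟩).mp hx, rfl⟩
    · rintro ⟨x, hx, rfl⟩
      exact ⟨(hmem x).mpr hx, x.2⟩
  rw [himage, Set.ncard_image_of_injective _ Subtype.val_injective, ← Nat.card_coe_set_eq]
  refine (Nat.card_congr (b.alcovePointsEquiv q fun _ => 0)).trans ?_
  simp [partitionCount]

open Classical in
-- Keeping distance `n + 1` from the walls with `w(αⱼ) > 0` uses up `(n + 1) asc(w)` of the total
-- `q`.
lemma ncard_alcovePairs_eq_sum [P.IsCrystallographic] [P.IsReduced] [P.IsIrreducible]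
    [Fintype P.weylGroup] (n q : ℕ) :
    (b.alcovePairs n q).ncard = ∑ w : P.weylGroup,
      if (n + 1) * b.asc w ≤ q then partitionCount b.extendedCoeff (q - (n + 1) * b.asc w)
      else 0 := by
  let m (w : P.weylGroup) (j : Option b.support) : ℕ :=
    if b.IsPos (P.weylGroupToPerm w (b.extendedRoot j)) then n + 1 else 0
  have hmem (p : P.weylGroup × b.coweightLattice) :
      p ∈ b.alcovePairs n q ↔ ∀ j, (m p.1 j : ℤ) ≤ b.extendedForm q j p.2 := by
    refine forall_congr' fun j => ?_
    by_cases h : b.IsPos (P.weylGroupToPerm p.1 (b.extendedRoot j))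
    · simp only [m, h, if_true, forall_const]; lia
    · simp only [m, h, if_false, false_imp_iff, and_true, Nat.cast_zero]
  have hm (w : P.weylGroup) : ∑ j, b.extendedCoeff j * m w j = (n + 1) * b.asc w := by
    simp only [m, asc, Finset.sum_filter, Finset.mul_sum]
    refine Finset.sum_congr rfl fun j _ => ?_
    split_ifs <;> ring
  let e : b.alcovePairs n q ≃ Σ w : P.weylGroup,
      {x : b.coweightLattice // ∀ j, (m w j : ℤ) ≤ b.extendedForm q j x} :=
    { toFun p := ⟨p.1.1, p.1.2, (hmem _).mp p.2⟩
      invFun s := ⟨(s.1, s.2.1), (hmem _).mpr s.2.2⟩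
      left_inv _ := rfl
      right_inv _ := rfl }
  have hfin (w : P.weylGroup) : Finite {a : Option b.support → ℕ //
      ∑ j, b.extendedCoeff j * a j + ∑ j, b.extendedCoeff j * m w j = q} := by
    refine Set.Finite.subset (finite_partitions b.extendedCoeff_pos
      (q - (n + 1) * b.asc w)) fun a ha => ?_
    have ha' : ∑ j, b.extendedCoeff j * a j + ∑ j, b.extendedCoeff j * m w j = q := ha
    rw [hm] at ha'
    exact Nat.eq_sub_of_add_eq ha'
  rw [← Nat.card_coe_set_eq, Nat.card_congr (e.trans
    (Equiv.sigmaCongrRight fun w => b.alcovePointsEquiv q (m w))), Nat.card_sigma]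
  refine Finset.sum_congr rfl fun w _ => ?_
  rw [hm]
  split_ifs with h
  · refine Nat.card_congr (Equiv.subtypeEquivRight fun a => ?_)
    lia
  · rw [Nat.card_eq_zero]
    exact Or.inl ⟨fun a => h (by have := a.2; lia)⟩

end AlcovePoints

/-! ### Counting pairs through residue classes -/

section Index

variable [P.IsCrystallographic] [P.IsReduced] [P.IsIrreducible]

/-- Pairs are matched with the product of the complement and the quotient by the coroot lattice, via
chosen representatives. -/
lemma ncard_alcovePairs (n : ℕ) {q : ℕ} (hq : 0 < q) :
    (b.alcovePairs n q).ncard =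
      (modComplement (b.truncatedAffineWeyl 1 n) q).ncard * b.connectionIndex := by
  have hout (k : b.coweightLattice ⧸ b.corootSublattice) :
    ∃ z : b.coweightLattice, (z : b.coweightLattice ⧸ b.corootSublattice) = k :=
    QuotientAddGroup.mk_surjective k
  choose r hr using ModN.mkQ_surjective (L := b.coweightLattice) q
  choose s hs using hout
  choose F hF X hX hFX using fun t : ModN b.coweightLattice q ×
      (b.coweightLattice ⧸ b.corootSublattice) => exists_mem_alcovePairs hq (r t.1) (s t.2)
  have hbij : Set.BijOn F (modComplement (b.truncatedAffineWeyl 1 n) q ×ˢ Set.univ)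
      (b.alcovePairs n q) := by
    refine ⟨fun t ht => ?_, fun t _ t' _ h => ?_, fun p hp => ?_⟩
    · refine (mem_alcovePairs_iff (hF t) (hFX t)).mpr ?_
      rw [← mkQ_mem_modComplement_iff, hr]
      exact ht.1
    · have h1 := hFX t
      have h2 := hFX t'
      rw [← h, h1] at h2
      have hrt : r t.1 = r t'.1 + (q : ℤ) • b.coweightAct (F t).1⁻¹
          (s t'.2 + X t' - (s t.2 + X t)) := by
        have h3 := congrArg (b.coweightAct (F t).1⁻¹) h2
        simp only [map_add, coweightAct_inv_coweightAct, map_zsmul] at h3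
        rw [map_sub, smul_sub, map_add, map_add, ← add_sub_assoc, ← h3]
        abel
      have ht1 : t.1 = t'.1 := by
        rw [← hr t.1, ← hr t'.1]
        exact ModN.mkQ_eq_mkQ_iff.mpr ⟨_, hrt⟩
      rw [ht1, add_right_inj] at h2
      have hst := natCast_smul_coweight_injective hq h2
      refine Prod.ext ht1 ?_
      rw [← hs t.2, ← hs t'.2, QuotientAddGroup.eq]
      have : -s t.2 + s t'.2 = X t - X t' := by
        rw [sub_eq_add_neg, neg_add_eq_iff_eq_add, ← add_assoc, ← sub_eq_add_neg, eq_sub_iff_add_eq]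
        exact hst.symm
      rw [this]
      exact sub_mem (hX t) (hX t')
    · have hp0 : p ∈ b.alcovePairs 0 q := fun j =>
        ⟨(hp j).1, fun h => lt_of_le_of_lt (by simp) ((hp j).2 h)⟩
      -- The discrepancy `c` between `y` and its chosen representative is absorbed into the class
      -- `k`.
      set y := b.coweightAct p.1⁻¹ p.2
      obtain ⟨c, hc⟩ := ModN.mkQ_eq_mkQ_iff.mp (hr (ModN.mkQ q y))
      set k : b.coweightLattice ⧸ b.corootSublattice := QuotientAddGroup.mk (-b.coweightAct p.1 c)
      have hk : -b.coweightAct p.1 c - s k ∈ b.corootSublattice := by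
        rw [sub_eq_neg_add, ← QuotientAddGroup.eq, hs]
      have hpeq : p.2 = b.coweightAct p.1 (r (ModN.mkQ q y)) +
          (q : ℤ) • (s k + (-b.coweightAct p.1 c - s k)) := by
        have hpy : b.coweightAct p.1 y = p.2 := by
          have h := b.coweightAct_inv_coweightAct p.1⁻¹ p.2
          rwa [inv_inv] at h
        rw [hc, map_add, hpy, map_zsmul]
        module
      have hFp : F (ModN.mkQ q y, k) = p :=
        eq_of_mem_alcovePairs (hF _) hp0 (hX _) hk (hFX _) hpeq
      refine ⟨(ModN.mkQ q y, k), ⟨?_, trivial⟩, hFp⟩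
      have h := (mem_alcovePairs_iff hp0 hpeq).mp hp
      rwa [← mkQ_mem_modComplement_iff, hr] at h
  rw [← hbij.image_eq, hbij.injOn.ncard_image, Set.ncard_prod, Set.ncard_univ,
    ← index_corootSublattice]
  rfl

/-- An infinite index would count as zero, but a finite nonempty set of pairs has cardinality a
multiple of the index. -/
lemma connectionIndex_ne_zero : b.connectionIndex ≠ 0 := by
  have := finite_weylGroup (P := P)
  have hfin : (b.alcovePairs 0 1).Finite := by
    have := finite_partitions b.extendedCoeff_pos 1
    have hx : Finite {x : b.coweightLattice // ∀ j, ((0 : ℕ) : ℤ) ≤ b.extendedForm (1 : ℕ) j x} :=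
      have : Finite {a : Option b.support → ℕ //
          ∑ j, b.extendedCoeff j * a j + ∑ j, b.extendedCoeff j * 0 = 1} := by simpa using this
      Finite.of_equiv _ (b.alcovePointsEquiv 1 fun _ => 0).symm
    have : Finite (b.alcovePairs 0 1) := Finite.of_injective
      (β := P.weylGroup ×
        {x : b.coweightLattice // ∀ j, ((0 : ℕ) : ℤ) ≤ b.extendedForm (1 : ℕ) j x})
      (fun p => (p.1.1, ⟨p.1.2, fun j => (p.2 j).1⟩)) fun p p' h => by
        simp only [Prod.mk.injEq, Subtype.mk.injEq] at h
        exact Subtype.ext (Prod.ext h.1 h.2)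
    exact Set.toFinite _
  obtain ⟨p, hp, -⟩ := exists_mem_alcovePairs (b := b) one_pos 0 0
  have h := (Set.ncard_pos hfin).mpr ⟨p, hp⟩
  rw [b.ncard_alcovePairs 0 one_pos] at h
  exact (pos_of_mul_pos_right h (Nat.zero_le _)).ne'

end Index

end RootPairing.Base
end

noncomputable section

/-! ### Closure and uniqueness of quasi-polynomials -/

namespace IsQuasiPolynomial

lemma zero : IsQuasiPolynomial fun _ => 0 := ⟨1, one_pos, 0, by simp⟩

lemma add {f g : ℤ → ℚ} (hf : IsQuasiPolynomial f) (hg : IsQuasiPolynomial g) :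
    IsQuasiPolynomial fun q => f q + g q := by
  obtain ⟨m, hm, F, hF⟩ := hf
  obtain ⟨k, hk, G, hG⟩ := hg
  refine ⟨m * k, Nat.mul_pos hm hk, fun r =>
    F (ZMod.castHom (dvd_mul_right m k) (ZMod m) r) +
      G (ZMod.castHom (dvd_mul_left k m) (ZMod k) r), fun q => ?_⟩
  beta_reduce
  rw [hF, hG, map_intCast, map_intCast, eval_add]

lemma const_mul {f : ℤ → ℚ} (hf : IsQuasiPolynomial f) (c : ℚ) :
    IsQuasiPolynomial fun q => c * f q := by
  obtain ⟨m, hm, F, hF⟩ := hf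
  exact ⟨m, hm, fun r => C c * F r, fun q => by beta_reduce; rw [hF, eval_mul, eval_C]⟩

lemma comp_sub {f : ℤ → ℚ} (hf : IsQuasiPolynomial f) (k : ℤ) :
    IsQuasiPolynomial fun q => f (q - k) := by
  obtain ⟨m, hm, F, hF⟩ := hf
  refine ⟨m, hm, fun r => (F (r - k)).comp (X - C (k : ℚ)), fun q => ?_⟩
  beta_reduce
  rw [hF]
  simp

lemma sum {κ : Type*} (s : Finset κ) {f : κ → ℤ → ℚ} (hf : ∀ j ∈ s, IsQuasiPolynomial (f j)) :
    IsQuasiPolynomial fun q => ∑ j ∈ s, f j q := by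
  classical
  induction s using Finset.induction_on with
  | empty => simpa using zero
  | insert a s ha ih =>
    simp_rw [Finset.sum_insert ha]
    exact (hf a (Finset.mem_insert_self a s)).add
      (ih fun j hj => hf j (Finset.mem_insert_of_mem hj))

lemma shiftAct {f : ℤ → ℚ} (hf : IsQuasiPolynomial f) (p : ℚ[X]) :
    IsQuasiPolynomial (shiftAct p f) :=
  sum p.support fun k _ => (hf.comp_sub k).const_mul (p.coeff k)

/-- A polynomial in `q / m` on the multiples of `m`, extended by zero. -/
lemma ite_dvd {m : ℕ} (hm : 0 < m) (p : ℚ[X]) :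
    IsQuasiPolynomial fun q => if (m : ℤ) ∣ q then p.eval ((q : ℚ) / m) else 0 := by
  refine ⟨m, hm, fun r => if r = 0 then p.comp (C (m : ℚ)⁻¹ * X) else 0, fun q => ?_⟩
  simp only [ZMod.intCast_zmod_eq_zero_iff_dvd]
  split_ifs
  · simp [div_eq_inv_mul]
  · simp

lemma eq_of_eventually_eq {f g : ℤ → ℚ} (hf : IsQuasiPolynomial f) (hg : IsQuasiPolynomial g)
    {q₀ : ℕ} (h : ∀ q : ℕ, q₀ < q → f q = g q) : f = g := by
  obtain ⟨m, hm, F, hF⟩ := hf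
  obtain ⟨k, hk, G, hG⟩ := hg
  funext q
  have hmk : 0 < m * k := Nat.mul_pos hm hk
  have key : F (q : ZMod m) = G (q : ZMod k) := by
    -- Infinitely many points beyond `q₀`, congruent to `q` modulo both periods.
    let x (t : ℕ) : ℤ := q + (m * k : ℕ) * ((q.natAbs + q₀ + 1 + t : ℕ) : ℤ)
    have hx (t : ℕ) : (q₀ : ℤ) < x t := by
      have h1 : (1 : ℤ) ≤ (m * k : ℕ) := by exact_mod_cast hmk
      have h2 : ((q.natAbs + q₀ + 1 + t : ℕ) : ℤ) ≤
        (m * k : ℕ) * ((q.natAbs + q₀ + 1 + t : ℕ) : ℤ) := le_mul_of_one_le_left (by positivity) h1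
      simp only [x]
      generalize ((m * k : ℕ) : ℤ) * ((q.natAbs + q₀ + 1 + t : ℕ) : ℤ) = y at h2
      lia
    refine eq_of_infinite_eval_eq _ _ (Set.infinite_of_injective_forall_mem
      (f := fun t : ℕ => (x t : ℚ)) (fun s t hst => ?_) fun t => ?_)
    · have h1 : x s = x t := Int.cast_injective (α := ℚ) hst
      have h2 := mul_left_cancel₀ (by exact_mod_cast hmk.ne') (add_left_cancel h1)
      lia
    · have h1 : f (x t) = g (x t) := by
        have := h (x t).toNat (by have := hx t; lia)
        rwa [Int.toNat_of_nonneg (by have := hx t; lia)] at this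
      rw [hF, hG] at h1
      have hxm : ((x t : ℤ) : ZMod m) = q := by simp [x]
      have hxk : ((x t : ℤ) : ZMod k) = q := by simp [x]
      rw [hxm, hxk] at h1
      exact h1
  rw [hF, hG, key]

end IsQuasiPolynomial

/-! ### The shift operator -/

section ShiftAct

variable (f : ℤ → ℚ) (q : ℤ)

lemma shiftAct_sum {κ : Type*} (s : Finset κ) (p : κ → ℚ[X]) :
    shiftAct (∑ j ∈ s, p j) f q = ∑ j ∈ s, shiftAct (p j) f q := by
  classical
  induction s using Finset.induction_on with
  | empty => simp [shiftAct]
  | insert a s ha ih =>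
    rw [Finset.sum_insert ha, Finset.sum_insert ha, ← ih]
    exact sum_add_index _ _ _ (by simp) (fun _ _ _ => add_mul _ _ _)

lemma shiftAct_C_mul (c : ℚ) (p : ℚ[X]) : shiftAct (C c * p) f q = c * shiftAct p f q := by
  rw [shiftAct, C_mul', sum_smul_index _ _ _ (by simp), shiftAct, sum_def, sum_def,
    Finset.mul_sum]
  simp_rw [mul_assoc]

lemma shiftAct_X_pow (k : ℕ) : shiftAct (X ^ k) f q = f (q - k) := by
  rw [shiftAct, X_pow_eq_monomial, sum_monomial_index _ _ (by simp), one_mul]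

end ShiftAct

/-! ### Partition counts are quasi-polynomial -/

section Partitions

variable {κ : Type*} [Fintype κ]

lemma natCard_sum_eq (k : ℕ) [Nonempty κ] :
    Nat.card {b : κ → ℕ // ∑ j, b j = k} =
      (k + (Fintype.card κ - 1)).choose (Fintype.card κ - 1) := by
  classical
  rw [← Nat.card_congr (Sym.equivNatSumOfFintype κ k), Nat.card_eq_fintype_card,
    Sym.card_sym_eq_choose]
  have := Fintype.card_pos (α := κ)
  rw [show Fintype.card κ + k - 1 = (k + (Fintype.card κ - 1)) by lia]
  exact Nat.choose_symm_add

lemma eval_preHilbertPoly_neg {d k : ℕ} (hk : 0 < k) (hkd : k ≤ d) :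
    (preHilbertPoly ℚ d 0).eval (-(k : ℚ)) = 0 := by
  have h : (ascPochhammer ℚ d).eval (-(k : ℚ) + 1) = 0 := by
    rw [ascPochhammer_eval_eq_zero_iff]
    exact ⟨k - 1, by lia, by rw [Nat.cast_pred hk]; ring⟩
  simp [preHilbertPoly, h]

/-- For `s < R` there are no solutions. The bound on `R` keeps the quotient above `-card κ`, where
the binomial polynomial has its negative integer zeros, so the formula still holds. -/
lemma natCard_mul_sum_add_eq [Nonempty κ] {m R s : ℕ} (hm : 0 < m) (hR : R < m * Fintype.card κ) :
    (Nat.card {b : κ → ℕ // m * ∑ j, b j + R = s} : ℚ) =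
      if (m : ℤ) ∣ (s : ℤ) - R then
        (preHilbertPoly ℚ (Fintype.card κ - 1) 0).eval ((((s : ℤ) - R : ℤ) : ℚ) / m) else 0 := by
  have hm' : (m : ℚ) ≠ 0 := by exact_mod_cast hm.ne'
  by_cases hk : ∃ k, s = m * k + R
  · obtain ⟨k, rfl⟩ := hk
    have h1 : ((m * k + R : ℕ) : ℤ) - R = m * k := by push_cast; ring
    rw [h1, if_pos (dvd_mul_right _ _)]
    push_cast
    rw [mul_div_cancel_left₀ _ hm', preHilbertPoly_eq_choose_sub_add _ _ (Nat.zero_le k),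
      Nat.sub_zero, ← natCard_sum_eq k (κ := κ)]
    congr 1
    refine Nat.card_congr (Equiv.subtypeEquivRight fun b => ?_)
    rw [add_left_inj, Nat.mul_right_inj hm.ne']
  · rw [Nat.card_eq_zero.mpr (Or.inl ⟨fun b => hk ⟨_, b.2.symm⟩⟩), Nat.cast_zero]
    split_ifs with hdvd
    · obtain ⟨t, ht⟩ := hdvd
      have ht0 : t < 0 := by
        by_contra! h0
        lift t to ℕ using h0
        exact hk ⟨t, by zify; linarith⟩
      obtain ⟨k, rfl⟩ := Int.exists_eq_neg_ofNat ht0.le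
      have hk0 : 0 < k := by lia
      have hlt : m * k < m * Fintype.card κ := by
        zify at hR ⊢
        nlinarith
      have hkd := lt_of_mul_lt_mul_left hlt (Nat.zero_le m)
      rw [ht]
      push_cast
      rw [mul_div_cancel_left₀ _ hm', eval_preHilbertPoly_neg hk0 (by lia)]
    · rfl

/-- Euclidean division of the parts of a partition. -/
def partitionsDivModEquiv {c e : κ → ℕ} {m : ℕ} (he : ∀ j, 0 < e j) (hce : ∀ j, c j * e j = m)
    (s : ℕ) : {a : κ → ℕ // ∑ j, c j * a j = s} ≃
      {p : (∀ j, Fin (e j)) × (κ → ℕ) // m * ∑ j, p.2 j + ∑ j, c j * (p.1 j : ℕ) = s} where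
  toFun a := ⟨(fun j => ⟨a.1 j % e j, Nat.mod_lt _ (he j)⟩, fun j => a.1 j / e j), by
    rw [Finset.mul_sum, ← Finset.sum_add_distrib]
    refine (Finset.sum_congr rfl fun j _ => ?_).trans a.2
    dsimp only
    rw [← hce j, mul_assoc, ← mul_add, Nat.div_add_mod]⟩
  invFun p := ⟨fun j => e j * p.1.2 j + p.1.1 j, by
    refine Eq.trans ?_ p.2
    rw [Finset.mul_sum, ← Finset.sum_add_distrib]
    refine Finset.sum_congr rfl fun j _ => ?_
    linear_combination (hce j) * (p.1.2 j)⟩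
  left_inv a := Subtype.ext (_root_.funext fun j => Nat.div_add_mod _ _)
  right_inv p := by
    refine Subtype.ext (Prod.ext (_root_.funext fun j => Fin.ext ?_) (_root_.funext fun j => ?_))
    · exact (Nat.mul_add_mod _ _ _).trans (Nat.mod_eq_of_lt (p.1.1 j).2)
    · change (e j * p.1.2 j + p.1.1 j) / e j = p.1.2 j
      rw [Nat.mul_add_div (he j), Nat.div_eq_of_lt (p.1.1 j).2, add_zero]

/-- The number of partitions of `s` with given part sizes is a quasi-polynomial in `s`. -/
lemma exists_isQuasiPolynomial_partitionCount [Nonempty κ] {c : κ → ℕ} (hc : ∀ j, 0 < c j) :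
    ∃ E : ℤ → ℚ, IsQuasiPolynomial E ∧ ∀ s : ℕ, E s = partitionCount c s := by
  classical
  set m := ∏ j, c j with hm
  have hm0 : 0 < m := Finset.prod_pos fun j _ => hc j
  have hce (j : κ) : c j * (m / c j) = m :=
    Nat.mul_div_cancel' (Finset.dvd_prod_of_mem c (Finset.mem_univ j))
  have he (j : κ) : 0 < m / c j := Nat.pos_of_mul_pos_left (hce j ▸ hm0)
  refine ⟨fun q => ∑ r : ∀ j, Fin (m / c j),
    if (m : ℤ) ∣ q - (∑ j, c j * (r j : ℕ) : ℕ) then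
      (preHilbertPoly ℚ (Fintype.card κ - 1) 0).eval
        (((q - (∑ j, c j * (r j : ℕ) : ℕ) : ℤ) : ℚ) / m) else 0,
    IsQuasiPolynomial.sum _ fun r _ =>
      (IsQuasiPolynomial.ite_dvd hm0 _).comp_sub (∑ j, c j * (r j : ℕ) : ℕ), fun s => ?_⟩
  have hfin := finite_partitions hc s
  let e : {a : κ → ℕ // ∑ j, c j * a j = s} ≃ Σ r : ∀ j, Fin (m / c j),
      {b : κ → ℕ // m * ∑ j, b j + ∑ j, c j * (r j : ℕ) = s} :=
    (partitionsDivModEquiv he hce s).trans (Equiv.subtypeProdEquivSigmaSubtype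
      fun (r : ∀ j, Fin (m / c j)) (b : κ → ℕ) => m * ∑ j, b j + ∑ j, c j * (r j : ℕ) = s)
  have hfin' (r : ∀ j, Fin (m / c j)) :
      Finite {b : κ → ℕ // m * ∑ j, b j + ∑ j, c j * (r j : ℕ) = s} :=
    Finite.of_injective (fun b => e.symm ⟨r, b⟩)
      ((Equiv.injective _).comp sigma_mk_injective)
  rw [partitionCount, Nat.card_congr e, Nat.card_sigma,
    Nat.cast_sum]
  refine Finset.sum_congr rfl fun r _ => (natCard_mul_sum_add_eq hm0 ?_).symm
  -- Each of the `card κ` remainder terms is less than `m`.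
  rw [mul_comm, ← smul_eq_mul, ← Finset.card_univ, ← Finset.sum_const]
  refine Finset.sum_lt_sum_of_nonempty Finset.univ_nonempty fun j _ => ?_
  calc c j * (r j : ℕ) < c j * (m / c j) := Nat.mul_lt_mul_of_pos_left (r j).2 (hc j)
    _ = m := hce j

end Partitions
end

noncomputable section

/-! ### Comparison of the two counts -/

namespace RootPairing.Base

variable {ι M N : Type*} [AddCommGroup M] [Module ℝ M] [AddCommGroup N] [Module ℝ N]
  {P : RootPairing ι ℝ M N} (b : P.Base) [Finite ι] [Nonempty ι]

lemma shiftAct_eulerianPolynomial_comp [Fintype P.weylGroup] (k : ℕ) (f : ℤ → ℚ) (q : ℤ) :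
    shiftAct (b.eulerianPolynomial.comp (X ^ k)) f q =
      (b.connectionIndex : ℚ)⁻¹ * ∑ w : P.weylGroup, f (q - (k * b.asc w : ℕ)) := by
  rw [eulerianPolynomial, finsum_eq_sum_of_fintype, mul_comp, C_comp, shiftAct_C_mul,
    sum_comp, shiftAct_sum]
  simp_rw [X_pow_comp, ← pow_mul, shiftAct_X_pow]

variable [P.IsCrystallographic] [P.IsReduced] [P.IsIrreducible]

lemma exists_isEhrhartQuasiPolynomial :
    ∃ E : ℤ → ℚ, IsEhrhartQuasiPolynomial b.coweightLattice b.closedFundamentalAlcove E ∧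
      ∀ s : ℕ, E s = partitionCount b.extendedCoeff s := by
  obtain ⟨E, hE, hEs⟩ := exists_isQuasiPolynomial_partitionCount b.extendedCoeff_pos
  exact ⟨E, ⟨hE, fun q hq => by rw [hEs, b.ncard_smul_closedFundamentalAlcove hq]⟩, hEs⟩

lemma isCharacteristicQuasiPolynomial_shiftAct {E : ℤ → ℚ} (hE : IsQuasiPolynomial E)
    (hEs : ∀ s : ℕ, E s = partitionCount b.extendedCoeff s) (n : ℕ) :
    IsCharacteristicQuasiPolynomial (b.truncatedAffineWeyl 1 n)
      (shiftAct (b.eulerianPolynomial.comp (X ^ (n + 1))) E) := by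
  have := finite_weylGroup (P := P)
  have := Fintype.ofFinite P.weylGroup
  -- Beyond this bound every shifted argument is nonnegative, so no summand is cut off.
  refine ⟨hE.shiftAct _, ∑ w : P.weylGroup, (n + 1) * b.asc w, fun q hq => ?_⟩
  have hle (w : P.weylGroup) : (n + 1) * b.asc w ≤ q :=
    (Finset.single_le_sum (f := fun w => (n + 1) * b.asc w) (fun _ _ => Nat.zero_le _)
      (Finset.mem_univ w)).trans hq.le
  have hcard := b.ncard_alcovePairs_eq_sum n q
  rw [b.ncard_alcovePairs n (Nat.zero_lt_of_lt hq)] at hcard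
  simp_rw [if_pos (hle _)] at hcard
  have hf : (b.connectionIndex : ℚ) ≠ 0 := Nat.cast_ne_zero.mpr b.connectionIndex_ne_zero
  rw [shiftAct_eulerianPolynomial_comp, inv_mul_eq_iff_eq_mul₀ hf, mul_comm, ← Nat.cast_mul,
    hcard, Nat.cast_sum]
  refine Finset.sum_congr rfl fun w _ => ?_
  rw [← Nat.cast_sub (hle w), hEs]

end RootPairing.Base

lemma IsEhrhartQuasiPolynomial.unique {V : Type*} [AddCommGroup V] [Module ℝ V]
    {L : Submodule ℤ V} {K : Set V} {E E' : ℤ → ℚ} (h : IsEhrhartQuasiPolynomial L K E)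
    (h' : IsEhrhartQuasiPolynomial L K E') : E = E' :=
  h.1.eq_of_eventually_eq h'.1 (q₀ := 0) fun q hq => (h.2 q hq).trans (h'.2 q hq).symm

lemma IsCharacteristicQuasiPolynomial.unique {L : Type*} [AddCommGroup L]
    {A : Set (Module.Dual ℤ L × ℤ)} {χ χ' : ℤ → ℚ} (h : IsCharacteristicQuasiPolynomial A χ)
    (h' : IsCharacteristicQuasiPolynomial A χ') : χ = χ' := by
  obtain ⟨hχ, q₀, hq₀⟩ := h
  obtain ⟨hχ', q₁, hq₁⟩ := h'
  exact hχ.eq_of_eventually_eq hχ' (q₀ := max q₀ q₁) fun q hq =>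
    (hq₀ q (lt_of_le_of_lt (le_max_left _ _) hq)).trans
      (hq₁ q (lt_of_le_of_lt (le_max_right _ _) hq)).symm

end

theorem theorem4p2 {ι M N : Type*} [Finite ι] [Nonempty ι]
    [AddCommGroup M] [Module ℝ M] [AddCommGroup N] [Module ℝ N]
    (P : RootPairing ι ℝ M N) [P.IsCrystallographic] [P.IsReduced] [P.IsIrreducible]
    (b : P.Base) (n : ℕ) (hn : 1 ≤ n) :
    (∃! E : ℤ → ℚ, IsEhrhartQuasiPolynomial b.coweightLattice b.closedFundamentalAlcove E) ∧
    (∃! χ : ℤ → ℚ, IsCharacteristicQuasiPolynomial (b.truncatedAffineWeyl 1 n) χ) ∧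
    ∀ E χ : ℤ → ℚ,
      IsEhrhartQuasiPolynomial b.coweightLattice b.closedFundamentalAlcove E →
      IsCharacteristicQuasiPolynomial (b.truncatedAffineWeyl 1 n) χ →
      ∀ q : ℤ, χ q = shiftAct (b.eulerianPolynomial.comp (X ^ (n + 1))) E q := by
  obtain ⟨E, hE, hEs⟩ := b.exists_isEhrhartQuasiPolynomial
  have hχ := b.isCharacteristicQuasiPolynomial_shiftAct hE.1 hEs n
  refine ⟨⟨E, hE, fun E' hE' => hE'.unique hE⟩, ⟨_, hχ, fun χ' hχ' => hχ'.unique hχ⟩,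
    fun E' χ' hE' hχ' q => ?_⟩
  rw [hE'.unique hE, hχ'.unique hχ]
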